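/- Let $\mathbb F_q$ be a finite field with $q$ elements, $A=\mathbb F_q[\theta]$, $K=\mathbb F_q(\theta)$, let $K_\infty=\mathbb F_q((1/\theta))$ be the completion of $K$ at the place $\infty$, and let $\mathbb C_\infty$ be the completion of an algebraic closure of $K_\infty$. Let $A_+\subset A$ be the set of monic polynomials. For $a\in A$ let $C_a(T)\in A[T]$ be the $\mathbb F_q$-linear polynomial attached to $a$ by the Carlitz module, i.e. the morphism of $\mathbb F_q$-algebras $A\to A[\tau]$, $\tau(f)=f^q$, determined by $C_\theta=\theta+\tau$. Put $D_0=1$, $D_i=(\theta^{q^i}-\theta)D_{i-1}^q$ for $i\ge1$. Let $s\ge 1$ and $\underline X=(X_1,\dots,X_s)$. For a power series $G\in Z\,\mathbb C_\infty[\underline X][[Z]]$ put $$\exp_C(G)=\sum_{i\ge 0}\frac{1}{D_i}\,G^{q^i}\in \mathbb C_\infty[\underline X][[Z]],$$ and for $F\in\mathbb C_\infty[\underline X]$ put $$\mathfrak L(F,Z)=\exp_C\Big(\sum_{a\in A_+}\frac{F(C_a(X_1),\dots,C_a(X_s))\,Z^{q^{\deg_\theta a}}}{a}\Big)\in\mathbb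 C_\infty[\underline X][[Z]].$$ Then $$\{F\in\mathbb C_\infty[\underline X]\;;\;\mathfrak L(F,Z)\in\mathbb C_\infty[\underline X,Z]\}=A[\underline X],$$ that is, for $F\in\mathbb C_\infty[\underline X]$, the series $\mathfrak L(F,Z)$ is a polynomial in $\underline X$ and $Z$ if and only if $F\in A[\underline X]$. -/

import Mathlib

open scoped NNReal

noncomputable section

namespace CarlitzLog

/-! ### The field `C_∞` -/

section Field

variable (𝔽 : Type*) [Field 𝔽]

/-- `K_∞ = 𝔽_q((1/θ))`: the completion of `K = 𝔽_q(θ)` at the infinite place. -/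
abbrev Kinf : Type _ := @RatFunc.CompletionAtInfty 𝔽 _ (Classical.decEq _)

instance : Valued (Kinf 𝔽) (WithZero (Multiplicative ℤ)) :=
  letI := Classical.decEq (RatFunc 𝔽)
  inferInstanceAs (Valued (RatFunc.CompletionAtInfty 𝔽) (WithZero (Multiplicative ℤ)))

instance : Algebra (RatFunc 𝔽) (Kinf 𝔽) :=
  letI := Classical.decEq (RatFunc 𝔽)
  inferInstanceAs (Algebra (RatFunc 𝔽) (RatFunc.CompletionAtInfty 𝔽))

variable [Fintype 𝔽]

lemma one_lt_card : (1 : ℝ≥0) < Fintype.card 𝔽 := by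
  exact_mod_cast Fintype.one_lt_card (α := 𝔽)

/-- The valuation at infinity has rank one; real absolute values are normalised by
`|α|_∞ = q ^ (-v_∞(α))`, so that `|θ|_∞ = q`. -/
instance rankOneKinf :
    (Valued.v : Valuation (Kinf 𝔽) (WithZero (Multiplicative ℤ))).RankOne where
  hom' := (WithZeroMulInt.toNNReal (one_lt_card 𝔽).ne_zero).comp
    MonoidWithZeroHom.ValueGroup₀.embedding
  strictMono' := (WithZeroMulInt.toNNReal_strictMono (one_lt_card 𝔽)).comp
    MonoidWithZeroHom.ValueGroup₀.embedding_strictMono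
  exists_val_nontrivial := by
    let _ := Classical.decEq (RatFunc 𝔽)
    let _ := RatFunc.inftyValued 𝔽
    refine ⟨((RatFunc.X : RatFunc 𝔽) : UniformSpace.Completion (RatFunc 𝔽)), ?_⟩
    have h : (Valued.v ((RatFunc.X : RatFunc 𝔽) : UniformSpace.Completion (RatFunc 𝔽)) :
        WithZero (Multiplicative ℤ)) = WithZero.exp 1 := by
      rw [Valued.valuedCompletion_apply]
      exact RatFunc.inftyValuation.X 𝔽
    change (Valued.v ((RatFunc.X : RatFunc 𝔽) : UniformSpace.Completion (RatFunc 𝔽)) :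
        WithZero (Multiplicative ℤ)) ≠ 0 ∧
      (Valued.v ((RatFunc.X : RatFunc 𝔽) : UniformSpace.Completion (RatFunc 𝔽)) :
        WithZero (Multiplicative ℤ)) ≠ 1
    rw [h]
    exact ⟨WithZero.exp_ne_zero, by decide⟩

instance : NontriviallyNormedField (Kinf 𝔽) :=
  Valued.toNontriviallyNormedField (Kinf 𝔽) (WithZero (Multiplicative ℤ))

instance : IsUltrametricDist (Kinf 𝔽) :=
  inferInstanceAs (@IsUltrametricDist (Kinf 𝔽)
    (Valued.toNormedField (Kinf 𝔽) (WithZero (Multiplicative ℤ))).toDist)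

instance : CompleteSpace (Kinf 𝔽) :=
  letI := Classical.decEq (RatFunc 𝔽)
  letI := RatFunc.inftyValued 𝔽
  inferInstanceAs (CompleteSpace (UniformSpace.Completion (RatFunc 𝔽)))

/-- An algebraic closure of `K_∞`, with the unique absolute value extending that of `K_∞`. -/
abbrev KinfAlgCl : Type _ := AlgebraicClosure (Kinf 𝔽)

instance : NormedField (KinfAlgCl 𝔽) := spectralNorm.normedField (Kinf 𝔽) (KinfAlgCl 𝔽)

/-- `C_∞`: the completion of an algebraic closure of `K_∞`. -/
def Cinf : Type _ := UniformSpace.Completion (KinfAlgCl 𝔽)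

instance : NormedField (Cinf 𝔽) :=
  inferInstanceAs (NormedField (UniformSpace.Completion (KinfAlgCl 𝔽)))

/-- The embedding of `K = 𝔽_q(θ)` in `C_∞`. -/
def ratFuncToCinf : RatFunc 𝔽 →+* Cinf 𝔽 :=
  (UniformSpace.Completion.coeRingHom : KinfAlgCl 𝔽 →+* UniformSpace.Completion (KinfAlgCl 𝔽)).comp
    ((algebraMap (Kinf 𝔽) (KinfAlgCl 𝔽)).comp (algebraMap (RatFunc 𝔽) (Kinf 𝔽)))

/-- `C_∞` as an algebra over `A = 𝔽_q[θ]`. -/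
instance : Algebra (Polynomial 𝔽) (Cinf 𝔽) :=
  ((ratFuncToCinf 𝔽).comp (algebraMap (Polynomial 𝔽) (RatFunc 𝔽))).toAlgebra

lemma algebraMap_Cinf_injective :
    Function.Injective (algebraMap (Polynomial 𝔽) (Cinf 𝔽)) :=
  (ratFuncToCinf 𝔽).injective.comp (IsFractionRing.injective (Polynomial 𝔽) (RatFunc 𝔽))

end Field

/-! ### The Carlitz module -/

section Carlitz

variable (𝔽 : Type*) [Field 𝔽] [Fintype 𝔽]

/-- `θ + τ`, where `τ(f) = f ^ q`, as an `𝔽_q`-linear operator on `A[T]`. -/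
def thetaAddTau : Module.End 𝔽 (Polynomial (Polynomial 𝔽)) :=
  LinearMap.mulLeft 𝔽 (Polynomial.C Polynomial.X) +
    (FiniteField.frobeniusAlgHom 𝔽 (Polynomial (Polynomial 𝔽))).toLinearMap

/-- The Carlitz module: the morphism of `𝔽_q`-algebras `a ↦ C_a` with `C_θ = θ + τ`, where
elements of `A[τ]` are viewed as operators on `A[T]`. -/
def carlitzModule : Polynomial 𝔽 →ₐ[𝔽] Module.End 𝔽 (Polynomial (Polynomial 𝔽)) :=
  Polynomial.aeval (thetaAddTau 𝔽)

variable {𝔽}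

/-- The `𝔽_q`-linear polynomial `C_a(T) ∈ A[T]`. -/
def carlitzPoly (a : Polynomial 𝔽) : Polynomial (Polynomial 𝔽) :=
  carlitzModule 𝔽 a Polynomial.X

variable (𝔽) in
/-- `D_0 = 1` and `D_i = (θ ^ (q ^ i) - θ) * D_{i-1} ^ q`. -/
def carlitzD : ℕ → Polynomial 𝔽
  | 0 => 1
  | i + 1 => (Polynomial.X ^ Fintype.card 𝔽 ^ (i + 1) - Polynomial.X) *
      carlitzD i ^ Fintype.card 𝔽

end Carlitz

/-! ### The series `𝔏(F, Z)` -/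

section Series

/-- The coefficientwise sum of a locally finite family of power series: for each `n`, only
finitely many members have a nonzero coefficient of degree `n`. -/
def formalSum {R ι : Type*} [CommRing R] (G : ι → PowerSeries R) : PowerSeries R :=
  PowerSeries.mk fun n => ∑ᶠ i, PowerSeries.coeff n (G i)

variable (𝔽 : Type*) [Field 𝔽] [Fintype 𝔽] {L : Type*} [Field L] [Algebra (Polynomial 𝔽) L]
  {σ : Type*}

/-- `exp_C(G) = ∑_{i ≥ 0} D_i⁻¹ τ^i(G)`, where `τ(G) = G ^ q`, for a power series `G` in `Z`
over `L[X]` without constant term. -/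
def carlitzExp (G : PowerSeries (MvPolynomial σ L)) : PowerSeries (MvPolynomial σ L) :=
  formalSum fun i : ℕ =>
    (algebraMap (Polynomial 𝔽) L (carlitzD 𝔽 i))⁻¹ • G ^ Fintype.card 𝔽 ^ i

variable {𝔽}

/-- `F(X) ↦ a * F = F(C_a(X_1), …, C_a(X_s))`. -/
def starPoly (a : Polynomial 𝔽) : MvPolynomial σ L →ₐ[L] MvPolynomial σ L :=
  MvPolynomial.aeval fun i => Polynomial.aeval (MvPolynomial.X i) (carlitzPoly a)

/-- `G(X, Z) ↦ a * G = G(C_a(X_1), …, C_a(X_s), Z ^ (q ^ deg a))`. -/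
def starSeries (a : Polynomial 𝔽) (G : PowerSeries (MvPolynomial σ L)) :
    PowerSeries (MvPolynomial σ L) :=
  PowerSeries.expand (Fintype.card 𝔽 ^ a.natDegree) (pow_ne_zero _ Fintype.card_ne_zero)
    (PowerSeries.map (starPoly (L := L) (σ := σ) a).toRingHom G)

variable (𝔽) in
/-- The terms `(a * (F Z)) / a`, for `a` monic in `A`, of the series `l(F, Z)`. -/
def smallLTerm (F : MvPolynomial σ L) (a : {a : Polynomial 𝔽 // a.Monic}) :
    PowerSeries (MvPolynomial σ L) :=
  (algebraMap (Polynomial 𝔽) L a)⁻¹ • starSeries (a : Polynomial 𝔽) (PowerSeries.C F * PowerSeries.X)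

variable (𝔽) in
/-- `l(F, Z) = ∑_{a ∈ A_+} (a * (F Z)) / a`. -/
def smallL (F : MvPolynomial σ L) : PowerSeries (MvPolynomial σ L) :=
  formalSum (smallLTerm 𝔽 F)

variable (𝔽) in
/-- `𝔏(F, Z) = exp_C(l(F, Z))`. -/
def bigL (F : MvPolynomial σ L) : PowerSeries (MvPolynomial σ L) :=
  carlitzExp 𝔽 (smallL 𝔽 F)

/-! The two families summed above are locally finite, so that the sums are the intended ones. -/

lemma smallLTerm_eq (F : MvPolynomial σ L) (a : {a : Polynomial 𝔽 // a.Monic}) :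
    smallLTerm 𝔽 F a = PowerSeries.monomial (Fintype.card 𝔽 ^ (a : Polynomial 𝔽).natDegree)
      ((algebraMap (Polynomial 𝔽) L a)⁻¹ • starPoly (a : Polynomial 𝔽) F) := by
  have h : PowerSeries.map (starPoly (L := L) (σ := σ) (a : Polynomial 𝔽)).toRingHom
      (PowerSeries.C F * PowerSeries.X) =
        PowerSeries.monomial 1 (starPoly (a : Polynomial 𝔽) F) := by
    rw [map_mul, PowerSeries.map_C, PowerSeries.map_X, PowerSeries.X_eq,
      ← PowerSeries.monomial_zero_eq_C_apply, PowerSeries.monomial_mul_monomial]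
    simp
  rw [smallLTerm, starSeries, h, PowerSeries.expand_monomial, mul_one]
  ext1 n
  simp [PowerSeries.coeff_monomial]

lemma smallLTerm_support_finite (F : MvPolynomial σ L) (n : ℕ) :
    (Function.support fun a => PowerSeries.coeff n (smallLTerm 𝔽 F a)).Finite := by
  have hfin : Set.Finite {p : Polynomial 𝔽 | p.natDegree < n} := by
    refine Set.Finite.of_injOn (f := fun p => fun i : Fin n => p.coeff i) (t := Set.univ)
      (fun _ _ => Set.mem_univ _) ?_ Set.finite_univ
    intro p hp r hr h
    ext i
    by_cases hi : i < n
    · exact congrFun h ⟨i, hi⟩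
    · simp only [Set.mem_ofPred_eq] at hp hr
      rw [Polynomial.coeff_eq_zero_of_natDegree_lt (by omega),
        Polynomial.coeff_eq_zero_of_natDegree_lt (by omega)]
  refine (hfin.preimage Subtype.val_injective.injOn).subset ?_
  intro a ha
  rw [Function.mem_support, smallLTerm_eq, PowerSeries.coeff_monomial] at ha
  have hn : n = Fintype.card 𝔽 ^ (a : Polynomial 𝔽).natDegree := by
    by_contra h
    exact ha (if_neg h)
  change (a : Polynomial 𝔽).natDegree < n
  rw [hn]
  exact Nat.lt_pow_self Fintype.one_lt_card

lemma carlitzExp_support_finite (G : PowerSeries (MvPolynomial σ L))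
    (hG : PowerSeries.constantCoeff G = 0) (n : ℕ) :
    (Function.support fun i : ℕ => PowerSeries.coeff n
      ((algebraMap (Polynomial 𝔽) L (carlitzD 𝔽 i))⁻¹ • G ^ Fintype.card 𝔽 ^ i)).Finite := by
  refine (Set.finite_Iic n).subset fun i hi => ?_
  by_contra h
  have hlt : n < Fintype.card 𝔽 ^ i :=
    (not_le.mp h).trans (Nat.lt_pow_self Fintype.one_lt_card)
  have h0 : PowerSeries.coeff n (G ^ Fintype.card 𝔽 ^ i) = 0 :=
    PowerSeries.X_pow_dvd_iff.mp (pow_dvd_pow_of_dvd (PowerSeries.X_dvd_iff.mpr hG) _) n hlt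
  exact hi (by simp [h0])

lemma constantCoeff_smallL (F : MvPolynomial σ L) :
    PowerSeries.constantCoeff (smallL 𝔽 F) = 0 := by
  rw [← PowerSeries.coeff_zero_eq_constantCoeff_apply, smallL, formalSum, PowerSeries.coeff_mk]
  refine finsum_eq_zero_of_forall_eq_zero fun a => ?_
  rw [smallLTerm_eq, PowerSeries.coeff_monomial, if_neg]
  exact (pow_pos Fintype.card_pos _).ne

end Series

end CarlitzLog

end

open scoped NNReal

noncomputable section

/-! Only the exponents `q ^ n` of `Z` occur in `𝔏(F, Z)`. Let `L_n` be the coefficient of `Z ^ (q ^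
n)` (`bigCoeff`); the series is a polynomial exactly when `L_n = 0` for all large `n`.

For `F` over `A` the vanishing is Anderson's argument, which plays integrality against smallness.
Integrality (`exists_map_eq_bigCoeff`): for a monic prime `P` of degree `d`, splitting the sum over
`a` according to `P ∣ a` gives `C_P(𝔏) = exp_C(P h) + P * 𝔏` with `h` integral at `P`. The
coefficients of `exp_C(P h)` are divisible by `P` because `D_i` has order less than `q ^ i` at `P`.
Apart from the term `P L_n`, the `n`-th coefficients of `C_P(𝔏)` and `P * 𝔏` are both congruent
modulo `P` to `L_{n-d} ^ (q ^ d)`, or to `0` if `n < d`. Hence `P L_n` is `P` times something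
integral at `P`.

Smallness (`norm_eval_bigCoeff_lt_one`): if the coordinates of `y` are killed by powers of `C_θ`,
all `C_a(y_i)` stay in one fixed disc, so `F(C_a(y))` is bounded by some `M` while `1 / a` shrinks,
and `|L_n(y)| < 1` once `q ^ n > M`. For integral torsion coordinates, `L_n(y)` is integral over `A`
and its conjugates are again values of `L_n` at torsion points. So `L_n(y) = 0`, and there are
enough such `y` to force `L_n = 0`.

Conversely, let `f` be the coefficient in `F` of a monomial `X ^ m` of maximal total degree. The
coefficient of `X ^ (q ^ n m)` in `L_n` is `E_n(f)`, with `E_n` (`carlitzE`) of degree `q ^ n`. The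
first half, applied to constants, shows that `E_n` vanishes at the `q ^ n` polynomials of degree
less than `n`, so it has no other roots. Thus `L_n = 0` forces `f ∈ A`; subtracting that monomial
gives an induction on the number of monomials. -/

namespace CarlitzLog

/-! ### Additivity of the `q ^ i`-th power map -/

section Frobenius

variable {𝔽 : Type*} [Field 𝔽] [Fintype 𝔽] {R : Type*} [CommRing R] [Algebra 𝔽 R]

variable (𝔽) in
lemma add_pow_card_pow (i : ℕ) (x y : R) :
    (x + y) ^ Fintype.card 𝔽 ^ i = x ^ Fintype.card 𝔽 ^ i + y ^ Fintype.card 𝔽 ^ i := by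
  induction i with
  | zero => simp
  | succ i ih =>
    simp only [pow_succ (Fintype.card 𝔽), pow_mul, ih]
    exact map_add (FiniteField.frobeniusAlgHom 𝔽 R) _ _

variable (𝔽) in
/-- The map `x ↦ x ^ (q ^ i)`. -/
def frobPow (i : ℕ) : R →+* R where
  toFun x := x ^ Fintype.card 𝔽 ^ i
  map_one' := one_pow _
  map_mul' x y := mul_pow x y _
  map_zero' := zero_pow (pow_ne_zero _ Fintype.card_ne_zero)
  map_add' := add_pow_card_pow 𝔽 i

variable (𝔽) in
lemma frobPow_apply (i : ℕ) (x : R) : frobPow 𝔽 i x = x ^ Fintype.card 𝔽 ^ i := rfl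

variable (𝔽) in
lemma sum_pow_card_pow (i : ℕ) {ι : Type*} (s : Finset ι) (f : ι → R) :
    (∑ k ∈ s, f k) ^ Fintype.card 𝔽 ^ i = ∑ k ∈ s, f k ^ Fintype.card 𝔽 ^ i :=
  map_sum (frobPow 𝔽 i) f s

variable (𝔽) in
lemma sub_pow_card_pow (i : ℕ) (x y : R) :
    (x - y) ^ Fintype.card 𝔽 ^ i = x ^ Fintype.card 𝔽 ^ i - y ^ Fintype.card 𝔽 ^ i :=
  map_sub (frobPow 𝔽 i) x y

/-- Additivity of Frobenius handles finite sums only, so the tail of `G` beyond degree `n` is split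
off first: its power is divisible by `X ^ ((n + 1) * q ^ i)` and does not reach degree `n`. -/
lemma coeff_pow_card_pow (G : PowerSeries R) (i n : ℕ) :
    PowerSeries.coeff n (G ^ Fintype.card 𝔽 ^ i) =
      if Fintype.card 𝔽 ^ i ∣ n then
        PowerSeries.coeff (n / Fintype.card 𝔽 ^ i) G ^ Fintype.card 𝔽 ^ i else 0 := by
  set Q := Fintype.card 𝔽 ^ i with hQ
  have hQ0 : 0 < Q := pow_pos Fintype.card_pos _
  have hsplit := PowerSeries.eq_X_pow_mul_shift_add_trunc (n + 1) G
  have htrunc : (PowerSeries.trunc (n + 1) G : PowerSeries R) =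
      ∑ k ∈ Finset.range (n + 1), PowerSeries.monomial k (PowerSeries.coeff k G) := by
    ext m
    simp [PowerSeries.coeff_trunc, PowerSeries.coeff_monomial]
  conv_lhs =>
    rw [hsplit, add_pow_card_pow, mul_pow, ← pow_mul, map_add, htrunc, sum_pow_card_pow, map_sum]
  rw [PowerSeries.coeff_X_pow_mul', if_neg (by nlinarith), zero_add]
  simp only [PowerSeries.monomial_pow, PowerSeries.coeff_monomial, ← hQ]
  split_ifs with h
  · obtain ⟨k, rfl⟩ := h
    rw [Nat.mul_div_cancel_left k hQ0, Finset.sum_eq_single k]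
    · simp
    · intro b _ hb
      rw [if_neg]
      intro h
      exact hb (Nat.eq_of_mul_eq_mul_left hQ0 h).symm
    · intro h
      exact absurd (Finset.mem_range.mpr (by nlinarith)) h
  · refine Finset.sum_eq_zero fun k _ => if_neg ?_
    rintro rfl
    exact h (dvd_mul_right _ _)

lemma polynomial_coeff_pow_card (f : Polynomial R) (n : ℕ) :
    (f ^ Fintype.card 𝔽).coeff n =
      if Fintype.card 𝔽 ∣ n then f.coeff (n / Fintype.card 𝔽) ^ Fintype.card 𝔽 else 0 := by
  have h := coeff_pow_card_pow (𝔽 := 𝔽) (f : PowerSeries R) 1 n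
  simpa only [pow_one, ← Polynomial.coe_pow, Polynomial.coeff_coe] using h

end Frobenius

/-! ### Coefficients of the Carlitz polynomials `C_a` -/

section Carlitz

open Polynomial

/-- Induction on polynomials by multiplication by `X`. -/
lemma polynomial_induction_X_mul {𝔽 : Type*} [CommSemiring 𝔽] {p : 𝔽[X] → Prop}
    (a : 𝔽[X]) (hC : ∀ c, p (C c))
    (hadd : ∀ a b, p a → p b → p (a + b)) (hX : ∀ a, p a → p (X * a)) : p a := by
  refine Polynomial.induction_on a hC hadd fun n c h => ?_
  have : C c * X ^ (n + 1) = X * (C c * X ^ n) := by ring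
  rw [this]
  exact hX _ h

variable {𝔽 : Type*} [Field 𝔽] [Fintype 𝔽]

lemma carlitzPoly_add (a b : 𝔽[X]) : carlitzPoly (a + b) = carlitzPoly a + carlitzPoly b := by
  simp [carlitzPoly]

lemma carlitzPoly_C (c : 𝔽) : carlitzPoly (C c) = C (C c) * X := by
  simp [carlitzPoly, carlitzModule, Algebra.smul_def]

lemma carlitzPoly_X_mul (a : 𝔽[X]) :
    carlitzPoly (X * a) = C X * carlitzPoly a + carlitzPoly a ^ Fintype.card 𝔽 := by
  simp [carlitzPoly, carlitzModule, thetaAddTau]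

/-- The coefficients `[a, j]` with `C_a(T) = ∑ j, [a, j] T ^ (q ^ j)`. -/
def carlitzCoeff (a : 𝔽[X]) (j : ℕ) : 𝔽[X] := (carlitzPoly a).coeff (Fintype.card 𝔽 ^ j)

lemma carlitzCoeff_add (a b : 𝔽[X]) (j : ℕ) :
    carlitzCoeff (a + b) j = carlitzCoeff a j + carlitzCoeff b j := by
  simp [carlitzCoeff, carlitzPoly_add]

lemma carlitzCoeff_C (c : 𝔽) (j : ℕ) :
    carlitzCoeff (C c) j = if j = 0 then C c else 0 := by
  rw [carlitzCoeff, carlitzPoly_C, coeff_C_mul, coeff_X]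
  rcases j with _ | j
  · simp
  · have h : (1 : ℕ) ≠ Fintype.card 𝔽 ^ (j + 1) :=
      (Nat.one_lt_pow j.succ_ne_zero Fintype.one_lt_card).ne
    simp [h]

lemma carlitzCoeff_X_mul_zero (a : 𝔽[X]) : carlitzCoeff (X * a) 0 = X * carlitzCoeff a 0 := by
  have h : ¬ Fintype.card 𝔽 ∣ 1 := fun h => Fintype.one_lt_card.ne' (Nat.dvd_one.mp h)
  rw [carlitzCoeff, carlitzPoly_X_mul, coeff_add, coeff_C_mul, polynomial_coeff_pow_card, pow_zero,
    if_neg h, add_zero, carlitzCoeff, pow_zero]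

lemma carlitzCoeff_X_mul_succ (a : 𝔽[X]) (j : ℕ) :
    carlitzCoeff (X * a) (j + 1) =
      X * carlitzCoeff a (j + 1) + carlitzCoeff a j ^ Fintype.card 𝔽 := by
  rw [carlitzCoeff, carlitzPoly_X_mul, coeff_add, coeff_C_mul, polynomial_coeff_pow_card, pow_succ,
    if_pos (dvd_mul_left _ _), Nat.mul_div_cancel _ Fintype.card_pos, carlitzCoeff, carlitzCoeff,
    pow_succ]

lemma coeff_carlitzPoly_eq_zero (a : 𝔽[X]) :
    ∀ n, (∀ j, n ≠ Fintype.card 𝔽 ^ j) → (carlitzPoly a).coeff n = 0 := by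
  induction a using polynomial_induction_X_mul with
  | hC c =>
    intro n hn
    rw [carlitzPoly_C, coeff_C_mul, coeff_X, if_neg, mul_zero]
    simpa using (hn 0).symm
  | hadd a b ha hb => intro n hn; rw [carlitzPoly_add, coeff_add, ha n hn, hb n hn, add_zero]
  | hX a ha =>
    intro n hn
    rw [carlitzPoly_X_mul, coeff_add, coeff_C_mul, ha n hn, mul_zero, zero_add,
      polynomial_coeff_pow_card]
    split_ifs with h
    · obtain ⟨k, rfl⟩ := h
      rw [Nat.mul_div_cancel_left _ Fintype.card_pos, ha, zero_pow Fintype.card_ne_zero]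
      rintro j rfl
      exact hn (j + 1) (by ring)
    · rfl

lemma carlitzCoeff_zero_right (a : 𝔽[X]) : carlitzCoeff a 0 = a := by
  induction a using polynomial_induction_X_mul with
  | hC c => simp [carlitzCoeff_C]
  | hadd a b ha hb => rw [carlitzCoeff_add, ha, hb]
  | hX a ha => rw [carlitzCoeff_X_mul_zero, ha]

/-- Writing `a = X * a.divX + c` lowers the degree; the top coefficient is then a `q`-th power of an
element of `𝔽`, hence that element itself. -/
lemma carlitzCoeff_of_natDegree_le (j : ℕ) (a : 𝔽[X]) (ha : a.natDegree ≤ j) :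
    carlitzCoeff a j = C (a.coeff j) ∧ ∀ k, j < k → carlitzCoeff a k = 0 := by
  induction j generalizing a with
  | zero =>
    obtain ⟨c, rfl⟩ : ∃ c, C c = a := ⟨_, (eq_C_of_natDegree_le_zero ha).symm⟩
    simp only [carlitzCoeff_C]
    exact ⟨by simp, fun k hk => if_neg hk.ne'⟩
  | succ j ih =>
    obtain ⟨h1, h2⟩ := ih a.divX (by rw [natDegree_divX_eq_natDegree_tsub_one]; omega)
    have key : ∀ k, carlitzCoeff a (k + 1) =
        X * carlitzCoeff a.divX (k + 1) + carlitzCoeff a.divX k ^ Fintype.card 𝔽 := by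
      intro k
      conv_lhs => rw [← divX_mul_X_add a, mul_comm, carlitzCoeff_add, carlitzCoeff_X_mul_succ,
        carlitzCoeff_C, if_neg k.succ_ne_zero, add_zero]
    refine ⟨?_, fun k hk => ?_⟩
    · rw [key, h2 _ j.lt_succ_self, h1, ← C_pow, FiniteField.pow_card, coeff_divX, mul_zero,
        zero_add]
    · obtain ⟨k, rfl⟩ : ∃ k', k = k' + 1 := ⟨k - 1, by omega⟩
      rw [key, h2 _ (by omega), h2 _ (by omega), mul_zero, zero_add,
        zero_pow Fintype.card_ne_zero]

lemma natDegree_carlitzPoly_le (a : 𝔽[X]) :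
    (carlitzPoly a).natDegree ≤ Fintype.card 𝔽 ^ a.natDegree := by
  refine natDegree_le_iff_coeff_eq_zero.mpr fun n hn => ?_
  by_cases h : ∃ j, n = Fintype.card 𝔽 ^ j
  · obtain ⟨j, rfl⟩ := h
    exact (carlitzCoeff_of_natDegree_le _ a le_rfl).2 j
      ((Nat.pow_lt_pow_iff_right Fintype.one_lt_card).mp hn)
  · push Not at h
    exact coeff_carlitzPoly_eq_zero a n h

lemma coeff_carlitzPoly_of_monic {a : 𝔽[X]} (ha : a.Monic) :
    (carlitzPoly a).coeff (Fintype.card 𝔽 ^ a.natDegree) = 1 := by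
  have h := (carlitzCoeff_of_natDegree_le _ a le_rfl).1
  rwa [ha.coeff_natDegree, C_1] at h

/-- The relation `C_a C_θ = C_θ C_a`, coefficientwise. -/
lemma carlitzCoeff_succ_mul (a : 𝔽[X]) (j : ℕ) :
    carlitzCoeff a (j + 1) * (X ^ Fintype.card 𝔽 ^ (j + 1) - X) =
      carlitzCoeff a j ^ Fintype.card 𝔽 - carlitzCoeff a j := by
  have hsub : ∀ x y : 𝔽[X], (x - y) ^ Fintype.card 𝔽 = x ^ Fintype.card 𝔽 - y ^ Fintype.card 𝔽 := by
    simpa using sub_pow_card_pow (R := 𝔽[X]) 𝔽 1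
  have hadd : ∀ x y : 𝔽[X], (x + y) ^ Fintype.card 𝔽 = x ^ Fintype.card 𝔽 + y ^ Fintype.card 𝔽 := by
    simpa using add_pow_card_pow (R := 𝔽[X]) 𝔽 1
  induction a using polynomial_induction_X_mul generalizing j with
  | hC c =>
    rw [carlitzCoeff_C, carlitzCoeff_C, if_neg j.succ_ne_zero]
    split_ifs
    · rw [← C_pow, FiniteField.pow_card]; ring
    · rw [zero_pow Fintype.card_ne_zero]; ring
  | hadd a b ha hb =>
    rw [carlitzCoeff_add, carlitzCoeff_add, add_mul, ha, hb, hadd]; ring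
  | hX a ha =>
    rcases j with _ | j
    · rw [carlitzCoeff_X_mul_succ, carlitzCoeff_X_mul_zero, mul_pow]
      have h := ha 0
      simp only [zero_add, pow_one] at h ⊢
      linear_combination X * h
    · rw [carlitzCoeff_X_mul_succ, carlitzCoeff_X_mul_succ, hadd, mul_pow]
      have h := ha (j + 1)
      have h' := congrArg (· ^ Fintype.card 𝔽) (ha j)
      simp only [mul_pow, hsub, ← pow_mul, ← pow_succ] at h' h ⊢
      linear_combination X * h + h'

/-- `C_b(C_a(x)) = C_{ab}(x)`. -/
lemma aeval_carlitzPoly_comp {S : Type*} [CommRing S] [Algebra 𝔽[X] S] (a b : 𝔽[X]) (x : S) :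
    aeval (aeval x (carlitzPoly a)) (carlitzPoly b) = aeval x (carlitzPoly (b * a)) := by
  induction b using polynomial_induction_X_mul with
  | hC c =>
    have : carlitzPoly (C c * a) = C (C c) * carlitzPoly a := by
      rw [← smul_eq_C_mul, carlitzPoly, map_smul, LinearMap.smul_apply, ← carlitzPoly,
        Algebra.smul_def]
      rfl
    rw [this, carlitzPoly_C]
    simp
  | hadd b c hb hc => simp only [add_mul, carlitzPoly_add, map_add, hb, hc]
  | hX b hb => simp only [mul_assoc, carlitzPoly_X_mul, map_add, map_mul, map_pow, hb, aeval_C]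

end Carlitz

/-! ### Monic polynomials of given degree -/

section Monic

open Polynomial

variable (𝔽 : Type*) [Field 𝔽] [Fintype 𝔽]

lemma finite_monic_natDegree_eq (d : ℕ) : {a : 𝔽[X] | a.Monic ∧ a.natDegree = d}.Finite := by
  refine Set.Finite.of_injOn (f := fun p => fun i : Fin (d + 1) => p.coeff i) (t := Set.univ)
    (fun _ _ => Set.mem_univ _) ?_ Set.finite_univ
  intro p hp r hr h
  simp only [Set.mem_ofPred_eq] at hp hr
  ext i
  by_cases hi : i < d + 1
  · exact congrFun h ⟨i, hi⟩
  · rw [coeff_eq_zero_of_natDegree_lt (by omega), coeff_eq_zero_of_natDegree_lt (by omega)]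

/-- The monic polynomials of degree `d`. -/
def monicsOfDegree (d : ℕ) : Finset 𝔽[X] := (finite_monic_natDegree_eq 𝔽 d).toFinset

variable {𝔽}

lemma mem_monicsOfDegree {d : ℕ} {a : 𝔽[X]} :
    a ∈ monicsOfDegree 𝔽 d ↔ a.Monic ∧ a.natDegree = d := by
  simp [monicsOfDegree]

lemma monicsOfDegree_zero : monicsOfDegree 𝔽 0 = {1} := by
  ext a
  rw [mem_monicsOfDegree, Finset.mem_singleton]
  exact ⟨fun h => h.1.natDegree_eq_zero.mp h.2, by rintro rfl; simp⟩

end Monic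

/-! ### Congruences modulo a prime `P`, and the orders of the `D_i` -/

section Congruence

open Polynomial

variable {𝔽 : Type*} [Field 𝔽] [Fintype 𝔽]

lemma dvd_X_pow_card_pow_natDegree_sub_X {P : 𝔽[X]} (hP : Irreducible P) :
    P ∣ X ^ Fintype.card 𝔽 ^ P.natDegree - X := by
  rw [← Nat.card_eq_fintype_card]
  exact hP.natDegree_dvd_iff_dvd_X_pow_card_pow_sub_X.mp dvd_rfl

lemma not_dvd_X_pow_card_pow_sub_X {P : 𝔽[X]} (hP : Irreducible P) {j : ℕ} (hj : 0 < j)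
    (hjP : j < P.natDegree) : ¬ P ∣ X ^ Fintype.card 𝔽 ^ j - X := by
  rw [← Nat.card_eq_fintype_card]
  exact fun h => (Nat.le_of_dvd hj (hP.natDegree_dvd_of_dvd_X_pow_card_pow_sub_X h)).not_gt hjP

/-- Fermat's little theorem in `A / P`, reduced to the case `a = θ` by additivity of Frobenius. -/
lemma dvd_pow_card_pow_natDegree_sub {P : 𝔽[X]} (hP : Irreducible P) (a : 𝔽[X]) :
    P ∣ a ^ Fintype.card 𝔽 ^ P.natDegree - a := by
  induction a using polynomial_induction_X_mul with
  | hC c => rw [← C_pow, FiniteField.pow_card_pow, sub_self]; exact dvd_zero _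
  | hadd a b ha hb =>
    rw [add_pow_card_pow, add_sub_add_comm]
    exact dvd_add ha hb
  | hX a ha =>
    have : (X * a) ^ Fintype.card 𝔽 ^ P.natDegree - X * a =
        (X ^ Fintype.card 𝔽 ^ P.natDegree - X) * a ^ Fintype.card 𝔽 ^ P.natDegree +
          X * (a ^ Fintype.card 𝔽 ^ P.natDegree - a) := by ring
    rw [this]
    exact dvd_add ((dvd_X_pow_card_pow_natDegree_sub_X hP).mul_right _) (ha.mul_left _)

/-- Induction with `carlitzCoeff_succ_mul`: the factor `θ ^ (q ^ (j + 1)) - θ` is prime to `P` as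
long as `j + 1 < deg P`. -/
lemma dvd_carlitzCoeff {P : 𝔽[X]} (hP : Irreducible P) :
    ∀ j < P.natDegree, P ∣ carlitzCoeff P j
  | 0, _ => by rw [carlitzCoeff_zero_right]
  | j + 1, hj => by
    have h : P ∣ carlitzCoeff P (j + 1) * (X ^ Fintype.card 𝔽 ^ (j + 1) - X) := by
      have ih := dvd_carlitzCoeff hP j (by omega)
      rw [carlitzCoeff_succ_mul]
      exact dvd_sub (ih.trans (dvd_pow_self _ Fintype.card_ne_zero)) ih
    exact (hP.prime.dvd_or_dvd h).resolve_right (not_dvd_X_pow_card_pow_sub_X hP j.succ_pos hj)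

lemma C_dvd_carlitzPoly_sub {P : 𝔽[X]} (hP : Irreducible P) (hm : P.Monic) :
    C P ∣ carlitzPoly P - X ^ Fintype.card 𝔽 ^ P.natDegree := by
  refine C_dvd_iff_dvd_coeff _ _ |>.mpr fun n => ?_
  rw [coeff_sub, coeff_X_pow]
  split_ifs with h
  · rw [h, coeff_carlitzPoly_of_monic hm, sub_self]
    exact dvd_zero _
  · rw [sub_zero]
    by_cases hn : ∃ j, n = Fintype.card 𝔽 ^ j
    · obtain ⟨j, rfl⟩ := hn
      have hj : j ≠ P.natDegree := fun hj => h (by rw [hj])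
      rcases hj.lt_or_gt with hj | hj
      · exact dvd_carlitzCoeff hP j hj
      · rw [← carlitzCoeff, (carlitzCoeff_of_natDegree_le _ P le_rfl).2 j hj]
        exact dvd_zero _
    · push Not at hn
      rw [coeff_carlitzPoly_eq_zero P n hn]
      exact dvd_zero _

/-- `g(C_P(X)) ≡ g ^ (q ^ deg P)` modulo `P`. -/
lemma C_dvd_aeval_carlitzPoly_sub {σ : Type*} {P : 𝔽[X]} (hP : Irreducible P) (hm : P.Monic)
    (g : MvPolynomial σ 𝔽[X]) :
    MvPolynomial.C P ∣ MvPolynomial.aeval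
      (fun i => aeval (MvPolynomial.X i : MvPolynomial σ 𝔽[X]) (carlitzPoly P)) g -
        g ^ Fintype.card 𝔽 ^ P.natDegree := by
  set I : Ideal (MvPolynomial σ 𝔽[X]) := Ideal.span {MvPolynomial.C P}
  rw [← Ideal.mem_span_singleton, ← Ideal.Quotient.mk_eq_mk_iff_sub_mem]
  have h : (Ideal.Quotient.mk I).comp (MvPolynomial.aeval
      (fun i => aeval (MvPolynomial.X i : MvPolynomial σ 𝔽[X]) (carlitzPoly P))).toRingHom =
        (Ideal.Quotient.mk I).comp (frobPow 𝔽 P.natDegree) := by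
    refine MvPolynomial.ringHom_ext (fun a => ?_) fun i => ?_
    · refine Ideal.Quotient.mk_eq_mk_iff_sub_mem _ _ |>.mpr (Ideal.mem_span_singleton.mpr ?_)
      rw [frobPow_apply, ← MvPolynomial.C_pow]
      change MvPolynomial.C P ∣ MvPolynomial.aeval _ (MvPolynomial.C a) - _
      rw [MvPolynomial.aeval_C, MvPolynomial.algebraMap_eq, ← MvPolynomial.C_sub]
      exact map_dvd MvPolynomial.C (dvd_sub_comm.mp (dvd_pow_card_pow_natDegree_sub hP a))
    · refine Ideal.Quotient.mk_eq_mk_iff_sub_mem _ _ |>.mpr (Ideal.mem_span_singleton.mpr ?_)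
      rw [frobPow_apply]
      change MvPolynomial.C P ∣ MvPolynomial.aeval _ (MvPolynomial.X i) - _
      rw [MvPolynomial.aeval_X]
      have h := map_dvd (aeval (MvPolynomial.X i : MvPolynomial σ 𝔽[X]))
        (C_dvd_carlitzPoly_sub hP hm)
      simpa using h
  exact DFunLike.congr_fun h g

lemma carlitzD_ne_zero (i : ℕ) : carlitzD 𝔽 i ≠ 0 := by
  induction i with
  | zero => exact one_ne_zero
  | succ i ih =>
    exact mul_ne_zero
      (FiniteField.X_pow_card_pow_sub_X_ne_zero 𝔽 i.succ_ne_zero Fintype.one_lt_card)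
      (pow_ne_zero _ ih)

lemma natDegree_carlitzD (i : ℕ) : (carlitzD 𝔽 i).natDegree = i * Fintype.card 𝔽 ^ i := by
  induction i with
  | zero => simp [carlitzD]
  | succ i ih =>
    rw [carlitzD, natDegree_mul
      (FiniteField.X_pow_card_pow_sub_X_ne_zero 𝔽 i.succ_ne_zero Fintype.one_lt_card)
      (pow_ne_zero _ (carlitzD_ne_zero i)), natDegree_pow, ih,
      FiniteField.X_pow_card_pow_sub_X_natDegree_eq 𝔽 i.succ_ne_zero Fintype.one_lt_card,
      Nat.succ_eq_add_one]
    ring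

lemma squarefree_X_pow_card_pow_sub_X {j : ℕ} (hj : j ≠ 0) :
    Squarefree (X ^ Fintype.card 𝔽 ^ j - X : 𝔽[X]) := by
  obtain ⟨p, hp⟩ := CharP.exists 𝔽
  refine (galois_poly_separable p _ ?_).squarefree
  rw [← CharP.cast_eq_zero_iff 𝔽 p]
  simp [hj]

/-- The order of `D_i` at a prime `P` is at most `q ^ i - 1`. -/
lemma exists_mul_pow_eq_mul_carlitzD {P : 𝔽[X]} (hP : Prime P) (i : ℕ) :
    ∃ u w : 𝔽[X], ¬ P ∣ u ∧ u * P ^ (Fintype.card 𝔽 ^ i - 1) = w * carlitzD 𝔽 i := by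
  induction i with
  | zero => exact ⟨1, 1, hP.not_dvd_one, by simp [carlitzD]⟩
  | succ i ih =>
    obtain ⟨u, w, hu, h⟩ := ih
    set y : 𝔽[X] := X ^ Fintype.card 𝔽 ^ (i + 1) - X with hy
    -- The order of `y` at `P` is at most one, since `y` is squarefree.
    obtain ⟨v, z, hv, hvz⟩ : ∃ v z : 𝔽[X], ¬ P ∣ v ∧ v * P = z * y := by
      by_cases hPy : P ∣ y
      · obtain ⟨v, hv⟩ := hPy
        refine ⟨v, 1, ?_, by rw [hv]; ring⟩
        rintro ⟨t, rfl⟩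
        refine hP.not_isUnit ((squarefree_X_pow_card_pow_sub_X (𝔽 := 𝔽) i.succ_ne_zero) P ⟨t, ?_⟩)
        rw [← hy, hv]; ring
      · exact ⟨y, P, hPy, mul_comm _ _⟩
    have hq : 2 ≤ Fintype.card 𝔽 := Fintype.one_lt_card
    have hqi : 1 ≤ Fintype.card 𝔽 ^ i := Nat.one_le_pow _ _ (by omega)
    -- The order of `D_{i+1}` is at most `(q ^ i - 1) q + 1`; the remaining `q - 2` is slack
    -- absorbed by the witness `w`.
    have hexp : Fintype.card 𝔽 ^ (i + 1) - 1 =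
        (Fintype.card 𝔽 ^ i - 1) * Fintype.card 𝔽 + (1 + (Fintype.card 𝔽 - 2)) := by
      obtain ⟨k, hk⟩ := Nat.exists_eq_add_of_le hqi
      obtain ⟨l, hl⟩ := Nat.exists_eq_add_of_le hq
      rw [pow_succ, hk, Nat.add_sub_cancel_left, hl, Nat.add_sub_cancel_left, add_mul]
      omega
    refine ⟨v * u ^ Fintype.card 𝔽, w ^ Fintype.card 𝔽 * z * P ^ (Fintype.card 𝔽 - 2), ?_, ?_⟩
    · exact fun hd => (hP.dvd_or_dvd hd).elim hv fun hd => hu (hP.dvd_of_dvd_pow hd)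
    · rw [hexp, pow_add, pow_add, pow_mul, pow_one, carlitzD, ← hy]
      calc v * u ^ Fintype.card 𝔽 * ((P ^ (Fintype.card 𝔽 ^ i - 1)) ^ Fintype.card 𝔽 *
            (P * P ^ (Fintype.card 𝔽 - 2)))
          = (u * P ^ (Fintype.card 𝔽 ^ i - 1)) ^ Fintype.card 𝔽 * (v * P) *
              P ^ (Fintype.card 𝔽 - 2) := by rw [mul_pow]; ring
        _ = _ := by rw [h, hvz, mul_pow]; ring

end Congruence

/-! ### The Carlitz exponential on coefficient sequences -/

section ExpSeq

open Polynomial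

variable {𝔽 : Type*} [Field 𝔽] [Fintype 𝔽] {L : Type*} [Field L] [Algebra 𝔽[X] L] {σ : Type*}

/-- `exp_C` on sequences: `u` stands for `∑ n, u n * Z ^ (q ^ n)`. -/
def expSeq (u : ℕ → MvPolynomial σ L) (n : ℕ) : MvPolynomial σ L :=
  ∑ i ∈ Finset.range (n + 1),
    (algebraMap 𝔽[X] L (carlitzD 𝔽 i))⁻¹ • u (n - i) ^ Fintype.card 𝔽 ^ i

/-- `S_d(F) = ∑ a, F(C_a(X)) / a` over the monic `a` of degree `d`. -/
def smallCoeff (F : MvPolynomial σ L) (d : ℕ) : MvPolynomial σ L :=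
  ∑ a ∈ monicsOfDegree 𝔽 d, (algebraMap 𝔽[X] L a)⁻¹ • starPoly a F

/-- The coefficient of `Z ^ (q ^ n)` in `𝔏(F, Z)`. -/
def bigCoeff (F : MvPolynomial σ L) (n : ℕ) : MvPolynomial σ L :=
  expSeq (𝔽 := 𝔽) (smallCoeff (𝔽 := 𝔽) F) n

lemma starPoly_starPoly (a b : 𝔽[X]) (F : MvPolynomial σ L) :
    starPoly a (starPoly b F) = starPoly (b * a) F := by
  have h : ((starPoly a).comp (starPoly b) : MvPolynomial σ L →ₐ[L] MvPolynomial σ L) =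
      starPoly (b * a) := by
    refine MvPolynomial.algHom_ext fun i => ?_
    rw [AlgHom.comp_apply, starPoly, starPoly, starPoly, MvPolynomial.aeval_X,
      MvPolynomial.aeval_X, ← aeval_carlitzPoly_comp]
    have h := aeval_algHom_apply ((MvPolynomial.aeval (R := L) fun i : σ =>
      aeval (MvPolynomial.X i : MvPolynomial σ L) (carlitzPoly a)).restrictScalars 𝔽[X])
      (MvPolynomial.X i) (carlitzPoly b)
    simpa using h.symm
  exact DFunLike.congr_fun h F

lemma starPoly_expSeq (a : 𝔽[X]) (u : ℕ → MvPolynomial σ L) (n : ℕ) :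
    starPoly a (expSeq (𝔽 := 𝔽) u n) = expSeq (𝔽 := 𝔽) (fun m => starPoly a (u m)) n := by
  simp only [expSeq, map_sum, map_smul, map_pow]

lemma starPoly_map (a : 𝔽[X]) (g : MvPolynomial σ 𝔽[X]) :
    starPoly a (MvPolynomial.map (algebraMap 𝔽[X] L) g) =
      MvPolynomial.map (algebraMap 𝔽[X] L) (MvPolynomial.aeval
        (fun i => aeval (MvPolynomial.X i : MvPolynomial σ 𝔽[X]) (carlitzPoly a)) g) := by
  induction g using MvPolynomial.induction_on with
  | C c => simp [starPoly]
  | add p q hp hq => simp only [map_add, hp, hq]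
  | mul_X p i hp =>
    rw [map_mul, map_mul, map_mul, map_mul, hp, MvPolynomial.map_X, starPoly,
      MvPolynomial.aeval_X, MvPolynomial.aeval_X]
    congr 1
    have h := aeval_algHom_apply (MvPolynomial.mapAlgHom (σ := σ) (Algebra.ofId 𝔽[X] L))
      (MvPolynomial.X i) (carlitzPoly a)
    change aeval (MvPolynomial.map (algebraMap 𝔽[X] L) (MvPolynomial.X i)) (carlitzPoly a) =
      MvPolynomial.map (algebraMap 𝔽[X] L) (aeval (MvPolynomial.X i) (carlitzPoly a)) at h
    rwa [MvPolynomial.map_X] at h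

/-- On sequences, the substitution `Z ↦ Z ^ (q ^ d)` is a shift by `d`, and `exp_C` commutes with
it. -/
lemma expSeq_shift (u : ℕ → MvPolynomial σ L) (d n : ℕ) :
    expSeq (𝔽 := 𝔽) (fun m => if d ≤ m then u (m - d) else 0) n =
      if d ≤ n then expSeq (𝔽 := 𝔽) u (n - d) else 0 := by
  have hz : ∀ i, (0 : MvPolynomial σ L) ^ Fintype.card 𝔽 ^ i = 0 :=
    fun i => zero_pow (pow_ne_zero _ Fintype.card_ne_zero)
  rw [expSeq]
  split_ifs with h
  · rw [expSeq]
    symm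
    refine Finset.sum_subset_zero_on_sdiff ?_ ?_ ?_
    · intro i; simp only [Finset.mem_range]; omega
    · intro i hi
      simp only [Finset.mem_sdiff, Finset.mem_range] at hi
      rw [if_neg (by omega), hz, smul_zero]
    · intro i hi
      simp only [Finset.mem_range] at hi
      rw [if_pos (by omega)]
      congr 3
      omega
  · refine Finset.sum_eq_zero fun i _ => ?_
    rw [if_neg (by omega), hz, smul_zero]

lemma smallCoeff_add (F G : MvPolynomial σ L) (n : ℕ) :
    smallCoeff (𝔽 := 𝔽) (F + G) n = smallCoeff (𝔽 := 𝔽) F n + smallCoeff (𝔽 := 𝔽) G n := by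
  simp only [smallCoeff, map_add, smul_add, Finset.sum_add_distrib]

lemma expSeq_X_smul_zero (u : ℕ → MvPolynomial σ L) :
    expSeq (𝔽 := 𝔽) (fun m => (X : 𝔽[X]) • u m) 0 = (X : 𝔽[X]) • expSeq (𝔽 := 𝔽) u 0 := by
  simp [expSeq, carlitzD]

variable [Algebra 𝔽 L]

lemma expSeq_add (u v : ℕ → MvPolynomial σ L) (n : ℕ) :
    expSeq (𝔽 := 𝔽) (fun m => u m + v m) n = expSeq (𝔽 := 𝔽) u n + expSeq (𝔽 := 𝔽) v n := by
  simp only [expSeq, add_pow_card_pow, smul_add, Finset.sum_add_distrib]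

lemma bigCoeff_add (F G : MvPolynomial σ L) (n : ℕ) :
    bigCoeff (𝔽 := 𝔽) (F + G) n = bigCoeff (𝔽 := 𝔽) F n + bigCoeff (𝔽 := 𝔽) G n := by
  rw [bigCoeff, bigCoeff, bigCoeff, ← expSeq_add]
  congr 1
  ext1 m
  exact smallCoeff_add F G m

variable (hinj : Function.Injective (algebraMap 𝔽[X] L))
include hinj

/-- This is `exp_C(θ G) = θ exp_C(G) + exp_C(G) ^ q`. Termwise it reduces to `(θ ^ (q ^ (i + 1)) -
θ) / D_{i+1} = 1 / D_i ^ q`, the recursion for `D`. -/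
lemma expSeq_X_smul_succ (u : ℕ → MvPolynomial σ L) (n : ℕ) :
    expSeq (𝔽 := 𝔽) (fun m => (X : 𝔽[X]) • u m) (n + 1) =
      (X : 𝔽[X]) • expSeq (𝔽 := 𝔽) u (n + 1) + expSeq (𝔽 := 𝔽) u n ^ Fintype.card 𝔽 := by
  have hD : ∀ i, algebraMap 𝔽[X] L (carlitzD 𝔽 i) ≠ 0 := fun i =>
    (map_ne_zero_iff _ hinj).mpr (carlitzD_ne_zero i)
  have h := sum_pow_card_pow 𝔽 1 (Finset.range (n + 1)) (fun i =>
    (algebraMap 𝔽[X] L (carlitzD 𝔽 i))⁻¹ • u (n - i) ^ Fintype.card 𝔽 ^ i)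
  rw [pow_one] at h
  rw [expSeq, expSeq, expSeq, h, Finset.sum_range_succ', Finset.sum_range_succ' _ (n + 1),
    smul_add, add_right_comm, Finset.smul_sum, ← Finset.sum_add_distrib]
  congr 1
  · refine Finset.sum_congr rfl fun i _ => ?_
    have hDi : algebraMap 𝔽[X] L (carlitzD 𝔽 (i + 1)) =
        (algebraMap 𝔽[X] L X ^ Fintype.card 𝔽 ^ (i + 1) - algebraMap 𝔽[X] L X) *
          algebraMap 𝔽[X] L (carlitzD 𝔽 i) ^ Fintype.card 𝔽 := by
      simp [carlitzD]
    have h1 := hD (i + 1)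
    rw [hDi] at h1
    have h2 := left_ne_zero_of_mul h1
    have h3 := hD i
    rw [Nat.add_sub_add_right, _root_.smul_pow, _root_.smul_pow, ← pow_mul, ← pow_succ, hDi,
      ← algebraMap_smul L ((X : 𝔽[X]) ^ _) (u (n - i) ^ _), ← algebraMap_smul L (X : 𝔽[X]),
      smul_smul, smul_smul, ← add_smul]
    congr 1
    rw [map_pow, inv_pow]
    field_simp
    ring
  · simp [carlitzD]

/-- `exp_C(a G) = C_a(exp_C(G))`. -/
lemma expSeq_smul (a : 𝔽[X]) (u : ℕ → MvPolynomial σ L) (n : ℕ) :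
    expSeq (𝔽 := 𝔽) (fun m => a • u m) n = ∑ j ∈ Finset.range (n + 1),
      carlitzCoeff a j • expSeq (𝔽 := 𝔽) u (n - j) ^ Fintype.card 𝔽 ^ j := by
  induction a using polynomial_induction_X_mul generalizing n with
  | hC c =>
    rw [Finset.sum_eq_single 0]
    · rw [carlitzCoeff_C, if_pos rfl, pow_zero, pow_one, Nat.sub_zero, expSeq, expSeq,
        Finset.smul_sum]
      refine Finset.sum_congr rfl fun i _ => ?_
      rw [_root_.smul_pow, ← C_pow, FiniteField.pow_card_pow, smul_comm]
    · intro j _ hj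
      rw [carlitzCoeff_C, if_neg hj, zero_smul]
    · exact fun h => absurd (Finset.mem_range.mpr n.succ_pos) h
  | hadd a b ha hb =>
    simp only [add_smul, expSeq_add, ha, hb, carlitzCoeff_add, Finset.sum_add_distrib]
  | hX a ha =>
    simp only [mul_smul]
    rcases n with _ | n
    · rw [expSeq_X_smul_zero, ha]
      simp [carlitzCoeff_X_mul_zero, mul_smul]
    · have h := sum_pow_card_pow 𝔽 1 (Finset.range (n + 1)) (fun j =>
        carlitzCoeff a j • expSeq (𝔽 := 𝔽) u (n - j) ^ Fintype.card 𝔽 ^ j)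
      rw [pow_one] at h
      rw [expSeq_X_smul_succ hinj, ha, ha, h, Finset.sum_range_succ',
        Finset.sum_range_succ' _ (n + 1), smul_add, add_right_comm, Finset.smul_sum,
        ← Finset.sum_add_distrib]
      congr 1
      · refine Finset.sum_congr rfl fun j _ => ?_
        rw [carlitzCoeff_X_mul_succ, add_smul, mul_smul, Nat.add_sub_add_right, _root_.smul_pow,
          ← pow_mul, ← pow_succ]
      · rw [carlitzCoeff_X_mul_zero, mul_smul]

end ExpSeq

/-! ### Integrality of the coefficients, one prime at a time -/

section Integrality

open Polynomial

variable {𝔽 : Type*} [Field 𝔽] {L : Type*} [Field L] [Algebra 𝔽[X] L] {σ : Type*}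

/-- `x` has coefficients in the localization of `A` at `P`. -/
def IsLocallyIntegral (P : 𝔽[X]) (x : MvPolynomial σ L) : Prop :=
  ∃ b : 𝔽[X], ¬ P ∣ b ∧ ∃ g : MvPolynomial σ 𝔽[X], b • x = MvPolynomial.map (algebraMap 𝔽[X] L) g

lemma map_smul_algebraMap (b : 𝔽[X]) (g : MvPolynomial σ 𝔽[X]) :
    MvPolynomial.map (algebraMap 𝔽[X] L) (b • g) =
      b • MvPolynomial.map (algebraMap 𝔽[X] L) g := by
  rw [MvPolynomial.smul_eq_C_mul, map_mul, MvPolynomial.map_C, ← MvPolynomial.smul_eq_C_mul,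
    algebraMap_smul]

lemma IsLocallyIntegral.add {P : 𝔽[X]} (hP : Prime P) {x y : MvPolynomial σ L}
    (hx : IsLocallyIntegral P x) (hy : IsLocallyIntegral P y) : IsLocallyIntegral P (x + y) := by
  obtain ⟨b, hb, g, hg⟩ := hx
  obtain ⟨c, hc, h, hh⟩ := hy
  refine ⟨b * c, fun hd => (hP.dvd_or_dvd hd).elim hb hc, c • g + b • h, ?_⟩
  rw [map_add, map_smul_algebraMap, map_smul_algebraMap, ← hg, ← hh, smul_add, mul_smul, mul_smul,
    smul_comm b c x]

lemma isLocallyIntegral_map {P : 𝔽[X]} (hP : Prime P) (g : MvPolynomial σ 𝔽[X]) :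
    IsLocallyIntegral P (MvPolynomial.map (algebraMap 𝔽[X] L) g) :=
  ⟨1, hP.not_dvd_one, g, one_smul _ _⟩

lemma isLocallyIntegral_sum {P : 𝔽[X]} (hP : Prime P) {ι : Type*} (s : Finset ι)
    (f : ι → MvPolynomial σ L) (h : ∀ i ∈ s, IsLocallyIntegral P (f i)) :
    IsLocallyIntegral P (∑ i ∈ s, f i) :=
  Finset.sum_induction f _ (fun _ _ hx hy => hx.add hP hy)
    (by simpa using isLocallyIntegral_map (L := L) (σ := σ) hP 0) h

lemma IsLocallyIntegral.pow {P : 𝔽[X]} (hP : Prime P) {x : MvPolynomial σ L}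
    (hx : IsLocallyIntegral P x) (n : ℕ) : IsLocallyIntegral P (x ^ n) := by
  obtain ⟨b, hb, g, hg⟩ := hx
  exact ⟨b ^ n, fun hd => hb (hP.dvd_of_dvd_pow hd), g ^ n, by
    rw [map_pow, ← hg, _root_.smul_pow]⟩

/-- An element of `L[X]` that is integral at all primes of `A` lies in `A[X]`. -/
lemma exists_map_eq_of_forall_isLocallyIntegral (x : MvPolynomial σ L)
    (h : ∀ P : 𝔽[X], Irreducible P → P.Monic → IsLocallyIntegral P x) :
    ∃ g, MvPolynomial.map (algebraMap 𝔽[X] L) g = x := by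
  classical
  -- The ideal of denominators of `x`; a maximal ideal containing it would contradict integrality at
  -- its generator.
  let I : Ideal 𝔽[X] :=
    { carrier := {b | ∃ g, b • x = MvPolynomial.map (algebraMap 𝔽[X] L) g}
      add_mem' := by
        rintro a b ⟨g, hg⟩ ⟨k, hk⟩
        exact ⟨g + k, by rw [add_smul, map_add, hg, hk]⟩
      zero_mem' := ⟨0, by rw [zero_smul, map_zero]⟩
      smul_mem' := by
        rintro c b ⟨g, hg⟩
        exact ⟨c • g, by rw [map_smul_algebraMap, ← hg, smul_eq_mul, mul_smul]⟩ }
  have hI : I = ⊤ := by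
    by_contra hI
    obtain ⟨M, hM, hIM⟩ := Ideal.exists_le_maximal I hI
    obtain ⟨Q, hQ⟩ := IsPrincipalIdealRing.principal M
    have hQ' : M = Ideal.span {Q} := hQ
    -- Integrality at the prime `X` already provides a nonzero denominator.
    have hQ0 : Q ≠ 0 := by
      rintro rfl
      obtain ⟨b, hb, g, hg⟩ := h X irreducible_X monic_X
      have hbM : b ∈ M := hIM ⟨g, hg⟩
      rw [hQ', Ideal.mem_span_singleton, zero_dvd_iff] at hbM
      exact hb (hbM ▸ dvd_zero _)
    have hirr : Irreducible Q :=
      ((Ideal.span_singleton_prime hQ0).mp (hQ' ▸ hM.isPrime)).irreducible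
    have hassoc : Associated Q (normalize Q) := associated_normalize Q
    obtain ⟨b, hb, g, hg⟩ := h (normalize Q) (hassoc.irreducible hirr) (monic_normalize hQ0)
    have hbM : b ∈ M := hIM ⟨g, hg⟩
    rw [hQ', Ideal.mem_span_singleton] at hbM
    exact hb (hassoc.dvd_iff_dvd_left.mp hbM)
  obtain ⟨g, hg⟩ : (1 : 𝔽[X]) ∈ I := hI ▸ Submodule.mem_top
  exact ⟨g, by rw [← hg, one_smul]⟩

lemma smul_right_injective_algebraMap (hinj : Function.Injective (algebraMap 𝔽[X] L))
    {P : 𝔽[X]} (hP : P ≠ 0) :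
    Function.Injective fun x : MvPolynomial σ L => P • x := by
  intro x y h
  simp only [← algebraMap_smul L P] at h
  exact smul_right_injective _ ((map_ne_zero_iff _ hinj).mpr hP) h

variable [Fintype 𝔽]

lemma sum_monicsOfDegree_dvd {M : Type*} [AddCommMonoid M] {P : 𝔽[X]} (hm : P.Monic) (n : ℕ)
    (f : 𝔽[X] → M) [DecidablePred (P ∣ ·)] :
    ∑ a ∈ monicsOfDegree 𝔽 n with P ∣ a, f a =
      if P.natDegree ≤ n then ∑ b ∈ monicsOfDegree 𝔽 (n - P.natDegree), f (b * P) else 0 := by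
  split_ifs with h
  · symm
    refine Finset.sum_bij (fun b _ => b * P) ?_ ?_ ?_ (fun _ _ => rfl)
    · intro b hb
      rw [mem_monicsOfDegree] at hb
      rw [Finset.mem_filter, mem_monicsOfDegree, hb.1.natDegree_mul hm, hb.2]
      exact ⟨⟨hb.1.mul hm, by omega⟩, dvd_mul_left _ _⟩
    · exact fun b _ c _ hbc => mul_right_cancel₀ hm.ne_zero hbc
    · intro a ha
      rw [Finset.mem_filter, mem_monicsOfDegree] at ha
      obtain ⟨⟨ha1, ha2⟩, b, rfl⟩ := ha
      have hb := hm.of_mul_monic_left ha1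
      refine ⟨b, ?_, mul_comm _ _⟩
      rw [hm.natDegree_mul hb] at ha2
      exact mem_monicsOfDegree.mpr ⟨hb, by omega⟩
  · refine Finset.sum_eq_zero fun a ha => absurd ?_ h
    rw [Finset.mem_filter, mem_monicsOfDegree] at ha
    rw [← ha.1.2]
    exact natDegree_le_of_dvd ha.2 ha.1.1.ne_zero

variable (hinj : Function.Injective (algebraMap 𝔽[X] L))
include hinj

/-- `P ^ (q ^ i - 1) / D_i` is integral at `P`, so `P ^ (q ^ i) / D_i` keeps a factor `P`. -/
lemma IsLocallyIntegral.inv_carlitzD_smul {P : 𝔽[X]} (hP : Prime P) {y : MvPolynomial σ L}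
    (hy : IsLocallyIntegral P y) (i : ℕ) :
    ∃ z, IsLocallyIntegral P z ∧ (algebraMap 𝔽[X] L (carlitzD 𝔽 i))⁻¹ •
      (P ^ Fintype.card 𝔽 ^ i • y) = P • z := by
  obtain ⟨u, w, hu, h⟩ := exists_mul_pow_eq_mul_carlitzD hP i
  obtain ⟨b, hb, g, hg⟩ := hy
  have hD : algebraMap 𝔽[X] L (carlitzD 𝔽 i) ≠ 0 :=
    (map_ne_zero_iff _ hinj).mpr (carlitzD_ne_zero i)
  have hq : 0 < Fintype.card 𝔽 ^ i := pow_pos Fintype.card_pos _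
  refine ⟨(algebraMap 𝔽[X] L (carlitzD 𝔽 i))⁻¹ • (P ^ (Fintype.card 𝔽 ^ i - 1) • y),
    ⟨b * u, fun hd => (hP.dvd_or_dvd hd).elim hb hu, w • g, ?_⟩, ?_⟩
  · have h' : u • ((algebraMap 𝔽[X] L (carlitzD 𝔽 i))⁻¹ • (P ^ (Fintype.card 𝔽 ^ i - 1) • y)) =
        w • y := by
      rw [smul_comm, smul_smul u, h, mul_comm w, mul_smul, ← algebraMap_smul L (carlitzD 𝔽 i),
        smul_smul, inv_mul_cancel₀ hD, one_smul]
    rw [mul_smul, h', smul_comm, hg, map_smul_algebraMap]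
  · rw [smul_comm P, smul_smul P, ← pow_succ', Nat.sub_add_cancel hq]

/-- For `a = b P` one has `P / a = 1 / b`, and acting by `a` is acting by `b` and then by `P`; so
the multiples of `P` reproduce the same sum in degree `n - deg P`. -/
lemma smul_smallCoeff (P : 𝔽[X]) (hm : P.Monic) (F : MvPolynomial σ L) (n : ℕ)
    [DecidablePred (P ∣ ·)] :
    P • smallCoeff (𝔽 := 𝔽) F n =
      P • (∑ a ∈ monicsOfDegree 𝔽 n with ¬ P ∣ a, (algebraMap 𝔽[X] L a)⁻¹ • starPoly a F) +
        if P.natDegree ≤ n then starPoly P (smallCoeff (𝔽 := 𝔽) F (n - P.natDegree)) else 0 := by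
  rw [smallCoeff, ← Finset.sum_filter_add_sum_filter_not _ (fun a => P ∣ a), add_comm, smul_add,
    sum_monicsOfDegree_dvd hm]
  congr 1
  split_ifs
  · rw [Finset.smul_sum, smallCoeff, map_sum]
    refine Finset.sum_congr rfl fun b _ => ?_
    have hP0 : algebraMap 𝔽[X] L P ≠ 0 := (map_ne_zero_iff _ hinj).mpr hm.ne_zero
    rw [map_smul, starPoly_starPoly, ← algebraMap_smul L P, smul_smul, map_mul, mul_inv,
      mul_left_comm, mul_inv_cancel₀ hP0, mul_one]
  · exact smul_zero _

variable [Algebra 𝔽 L]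

/-- Anderson's theorem, integrality part: the coefficients of `𝔏(F, Z)` are in `A[X]` if `F` is. -/
theorem exists_map_eq_bigCoeff (F : MvPolynomial σ 𝔽[X]) (n : ℕ) :
    ∃ g, MvPolynomial.map (algebraMap 𝔽[X] L) g =
      bigCoeff (𝔽 := 𝔽) (MvPolynomial.map (algebraMap 𝔽[X] L) F) n := by
  classical
  induction n using Nat.strong_induction_on with
  | _ n ih =>
  choose! g hg using ih
  refine exists_map_eq_of_forall_isLocallyIntegral _ fun P hirr hm => ?_
  have hP := hirr.prime
  have hd : 0 < P.natDegree := hirr.natDegree_pos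
  set G := MvPolynomial.map (algebraMap 𝔽[X] L) F with hG
  set h : ℕ → MvPolynomial σ L := fun n =>
    ∑ a ∈ monicsOfDegree 𝔽 n with ¬ P ∣ a, (algebraMap 𝔽[X] L a)⁻¹ • starPoly a G with hh
  have h_int : ∀ m, IsLocallyIntegral P (h m) := fun m => by
    refine isLocallyIntegral_sum hP _ _ fun a ha => ?_
    rw [Finset.mem_filter, mem_monicsOfDegree] at ha
    refine ⟨a, ha.2, MvPolynomial.aeval
        (fun i => aeval (MvPolynomial.X i : MvPolynomial σ 𝔽[X]) (carlitzPoly a)) F, ?_⟩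
    · rw [← starPoly_map, ← algebraMap_smul L a, smul_smul, mul_inv_cancel₀, one_smul]
      exact (map_ne_zero_iff _ hinj).mpr ha.1.1.ne_zero
  obtain ⟨z, hz, hPz⟩ : ∃ z, IsLocallyIntegral P z ∧
      expSeq (𝔽 := 𝔽) (fun m => P • h m) n = P • z := by
    choose z hz hPz using fun i =>
      ((h_int (n - i)).pow hP (Fintype.card 𝔽 ^ i)).inv_carlitzD_smul hinj hP i
    refine ⟨∑ i ∈ Finset.range (n + 1), z i, isLocallyIntegral_sum hP _ _ fun i _ => hz i, ?_⟩
    rw [expSeq, Finset.smul_sum]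
    exact Finset.sum_congr rfl fun i _ => by rw [_root_.smul_pow, hPz]
  -- The `n`-th coefficient of `exp_C(P l) = exp_C(P h) + P * 𝔏`; the left side is then expanded as
  -- `C_P(𝔏)`.
  have h1 : expSeq (𝔽 := 𝔽) (fun m => P • smallCoeff (𝔽 := 𝔽) G m) n =
      P • z + if P.natDegree ≤ n then starPoly P (bigCoeff (𝔽 := 𝔽) G (n - P.natDegree)) else 0 := by
    simp only [smul_smallCoeff hinj P hm]
    rw [expSeq_add, expSeq_shift (fun m => starPoly P (smallCoeff (𝔽 := 𝔽) G m)), hPz]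
    simp only [bigCoeff, starPoly_expSeq]
  rw [expSeq_smul hinj, Finset.sum_range_succ', carlitzCoeff_zero_right] at h1
  set star : MvPolynomial σ 𝔽[X] → MvPolynomial σ 𝔽[X] := fun g => MvPolynomial.aeval
    (fun i => aeval (MvPolynomial.X i : MvPolynomial σ 𝔽[X]) (carlitzPoly P)) g with hstar
  -- With the term `P L_n` set aside, only `j + 1 = deg P` survives modulo `P`, and it cancels
  -- against the star action because both are a `q ^ deg P`-th power. The induction hypothesis puts
  -- these terms in `A[X]`.
  obtain ⟨r, hr⟩ : MvPolynomial.C P ∣ (∑ j ∈ Finset.range n,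
      carlitzCoeff P (j + 1) • g (n - (j + 1)) ^ Fintype.card 𝔽 ^ (j + 1)) -
        if P.natDegree ≤ n then star (g (n - P.natDegree)) else 0 := by
    have hlow : ∀ j, j + 1 ≠ P.natDegree → MvPolynomial.C P ∣
        carlitzCoeff P (j + 1) • g (n - (j + 1)) ^ Fintype.card 𝔽 ^ (j + 1) := by
      intro j hj
      rw [MvPolynomial.smul_eq_C_mul]
      refine Dvd.dvd.mul_right (_root_.map_dvd MvPolynomial.C ?_) _
      rcases hj.lt_or_gt with hj | hj
      · exact dvd_carlitzCoeff hirr _ hj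
      · rw [(carlitzCoeff_of_natDegree_le _ P le_rfl).2 _ hj]
        exact dvd_zero _
    split_ifs with hdn
    · have hmem : P.natDegree - 1 ∈ Finset.range n := Finset.mem_range.mpr (by omega)
      rw [← Finset.add_sum_erase _ _ hmem, Nat.sub_add_cancel hd, add_sub_right_comm]
      refine dvd_add ?_ (Finset.dvd_sum fun j hj => hlow j ?_)
      · rw [(carlitzCoeff_of_natDegree_le _ P le_rfl).1, hm.coeff_natDegree, C_1, one_smul]
        exact dvd_sub_comm.mp (C_dvd_aeval_carlitzPoly_sub hirr hm _)
      · have := Finset.ne_of_mem_erase hj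
        omega
    · rw [sub_zero]
      refine Finset.dvd_sum fun j hj => hlow j ?_
      have := Finset.mem_range.mp hj
      omega
  have h2 : P • bigCoeff (𝔽 := 𝔽) G n =
      P • (z + MvPolynomial.map (algebraMap 𝔽[X] L) (-r)) := by
    rw [smul_add, map_neg, smul_neg, ← map_smul_algebraMap, MvPolynomial.smul_eq_C_mul, ← hr,
      map_sub, map_sum]
    have h3 : ∀ j ∈ Finset.range n, MvPolynomial.map (algebraMap 𝔽[X] L)
        (carlitzCoeff P (j + 1) • g (n - (j + 1)) ^ Fintype.card 𝔽 ^ (j + 1)) =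
          carlitzCoeff P (j + 1) • expSeq (𝔽 := 𝔽) (smallCoeff (𝔽 := 𝔽) G) (n - (j + 1)) ^
            Fintype.card 𝔽 ^ (j + 1) := by
      intro j hj
      rw [map_smul_algebraMap, map_pow, hg _ (by have := Finset.mem_range.mp hj; omega), bigCoeff]
    have h4 : MvPolynomial.map (algebraMap 𝔽[X] L)
        (if P.natDegree ≤ n then star (g (n - P.natDegree)) else 0) =
          if P.natDegree ≤ n then starPoly P (bigCoeff (𝔽 := 𝔽) G (n - P.natDegree)) else 0 := by
      split_ifs
      · rw [hstar, ← starPoly_map, hg _ (by omega)]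
      · exact map_zero _
    rw [Finset.sum_congr rfl h3, h4]
    rw [Nat.sub_zero, pow_zero, pow_one, ← bigCoeff] at h1
    linear_combination h1
  rw [smul_right_injective_algebraMap hinj hm.ne_zero h2]
  exact hz.add hP (isLocallyIntegral_map hP _)

end Integrality

/-! ### Torsion of the Carlitz module at powers of `θ` -/

section Torsion

open Polynomial

variable {𝔽 : Type*} [Field 𝔽] [Fintype 𝔽] {S : Type*} [CommRing S] [Algebra 𝔽[X] S] [Algebra 𝔽 S]

variable (𝔽 S) in
/-- The action `x ↦ θ x + x ^ q` of `C_θ`. -/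
def carlitzTheta : S →+ S where
  toFun x := algebraMap 𝔽[X] S X * x + x ^ Fintype.card 𝔽
  map_zero' := by simp
  map_add' x y := by
    have h := add_pow_card_pow 𝔽 1 x y
    rw [pow_one] at h
    rw [h]; ring

lemma carlitzTheta_apply (x : S) :
    carlitzTheta 𝔽 S x = algebraMap 𝔽[X] S X * x + x ^ Fintype.card 𝔽 := rfl

variable (𝔽 S) in
/-- The elements killed by `C_{θ^k}` for some `k`. -/
def thetaTorsion : AddSubgroup S where
  carrier := {x | ∃ k, (carlitzTheta 𝔽 S)^[k] x = 0}
  zero_mem' := ⟨0, rfl⟩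
  add_mem' := by
    rintro x y ⟨k, hk⟩ ⟨l, hl⟩
    refine ⟨k + l, ?_⟩
    rw [iterate_map_add, add_comm k l, Function.iterate_add_apply _ l k x, hk, add_comm l k,
      Function.iterate_add_apply _ k l y, hl, iterate_map_zero, iterate_map_zero, add_zero]
  neg_mem' := by
    rintro x ⟨k, hk⟩
    exact ⟨k, by rw [iterate_map_neg, hk, neg_zero]⟩

lemma carlitzTheta_mem_thetaTorsion_iff {x : S} :
    carlitzTheta 𝔽 S x ∈ thetaTorsion 𝔽 S ↔ x ∈ thetaTorsion 𝔽 S := by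
  constructor
  · rintro ⟨k, hk⟩
    exact ⟨k + 1, hk⟩
  · rintro ⟨k, hk⟩
    refine ⟨k, ?_⟩
    rw [← Function.iterate_succ_apply, Function.iterate_succ_apply', hk, map_zero]

lemma C_mul_mem_thetaTorsion (c : 𝔽) {x : S} (hx : x ∈ thetaTorsion 𝔽 S) :
    algebraMap 𝔽[X] S (C c) * x ∈ thetaTorsion 𝔽 S := by
  obtain ⟨k, hk⟩ := hx
  refine ⟨k, ?_⟩
  have h : Function.Semiconj (fun y => algebraMap 𝔽[X] S (C c) * y) (carlitzTheta 𝔽 S)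
      (carlitzTheta 𝔽 S) := fun y => by
    simp only [carlitzTheta_apply, mul_pow, ← map_pow, FiniteField.pow_card]
    ring
  have h' := (h.iterate_right k) x
  simp only [hk, mul_zero] at h'
  exact h'.symm

lemma aeval_carlitzPoly_mem_thetaTorsion (a : 𝔽[X]) {x : S} (hx : x ∈ thetaTorsion 𝔽 S) :
    aeval x (carlitzPoly a) ∈ thetaTorsion 𝔽 S := by
  induction a using polynomial_induction_X_mul with
  | hC c => simpa [carlitzPoly_C] using C_mul_mem_thetaTorsion c hx
  | hadd a b ha hb => rw [carlitzPoly_add, map_add]; exact add_mem ha hb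
  | hX a ha =>
    have := carlitzTheta_mem_thetaTorsion_iff.mpr ha
    rw [carlitzPoly_X_mul, map_add, map_mul, map_pow, aeval_C]
    exact this

lemma map_mem_thetaTorsion {S' : Type*} [CommRing S'] [Algebra 𝔽[X] S'] [Algebra 𝔽 S']
    (f : S →+* S') (hf : ∀ a, f (algebraMap 𝔽[X] S a) = algebraMap 𝔽[X] S' a) {x : S}
    (hx : x ∈ thetaTorsion 𝔽 S) : f x ∈ thetaTorsion 𝔽 S' := by
  obtain ⟨k, hk⟩ := hx
  refine ⟨k, ?_⟩
  have h : Function.Semiconj f (carlitzTheta 𝔽 S) (carlitzTheta 𝔽 S') := fun y => by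
    simp only [carlitzTheta_apply, map_add, map_mul, map_pow, hf]
  rw [← (h.iterate_right k) x, hk, map_zero]

/-- `C_θ` maps this set onto itself, since `T ^ q + θ T = y` is a monic equation, but not
injectively, since it kills a root of `z ^ (q - 1) = -θ`. A finite set admits no such map. -/
lemma infinite_integral_thetaTorsion {E : Type*} [Field E] [IsAlgClosed E] [Algebra 𝔽[X] E]
    [Algebra 𝔽 E] (hinj : Function.Injective (algebraMap 𝔽[X] E)) :
    {x : E | x ∈ thetaTorsion 𝔽 E ∧ IsIntegral 𝔽[X] x}.Infinite := by
  have hq : 2 ≤ Fintype.card 𝔽 := Fintype.one_lt_card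
  set T := {x : E | x ∈ thetaTorsion 𝔽 E ∧ IsIntegral 𝔽[X] x} with hT
  have hsurj : ∀ y ∈ T, ∃ x ∈ T, carlitzTheta 𝔽 E x = y := by
    rintro y ⟨hy, hyi⟩
    let B := integralClosure 𝔽[X] E
    let y' : B := ⟨y, hyi⟩
    let p : B[X] := X ^ Fintype.card 𝔽 + (C (algebraMap 𝔽[X] B X) * X + C (-y'))
    have hlt : (C (algebraMap 𝔽[X] B X) * X + C (-y')).degree < ((Fintype.card 𝔽 : ℕ) : WithBot ℕ) :=
      degree_linear_le.trans_lt (by exact_mod_cast (by omega : 1 < Fintype.card 𝔽))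
    have hp : p.Monic := monic_X_pow_add hlt
    obtain ⟨x, hx⟩ := IsAlgClosed.exists_root (p.map (algebraMap B E)) (by
      rw [hp.degree_map, degree_add_eq_left_of_degree_lt (by rwa [degree_X_pow]), degree_X_pow]
      exact_mod_cast (by omega : Fintype.card 𝔽 ≠ 0))
    have hxy : carlitzTheta 𝔽 E x = y := by
      have hx' : x ^ Fintype.card 𝔽 + (algebraMap 𝔽[X] E X * x - y) = 0 := by
        simpa [p, y', IsRoot.def, sub_eq_add_neg, Subalgebra.algebraMap_def] using hx
      rw [carlitzTheta_apply]
      linear_combination hx'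
    refine ⟨x, ⟨carlitzTheta_mem_thetaTorsion_iff.mp (hxy ▸ hy), ?_⟩, hxy⟩
    have : IsIntegral B x := ⟨p, hp, by rwa [IsRoot.def, eval_map] at hx⟩
    exact isIntegral_trans x this
  have hmaps : ∀ x ∈ T, carlitzTheta 𝔽 E x ∈ T := fun x hx =>
    ⟨carlitzTheta_mem_thetaTorsion_iff.mpr hx.1,
      ((isIntegral_algebraMap (x := (X : 𝔽[X]))).mul hx.2).add (hx.2.pow _)⟩
  intro hfin
  have := hfin.to_subtype
  let f : T → T := fun x => ⟨carlitzTheta 𝔽 E x, hmaps x x.2⟩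
  have hf : Function.Injective f := Finite.injective_iff_surjective.mpr fun y => by
    obtain ⟨x, hx, hxy⟩ := hsurj y y.2
    exact ⟨⟨x, hx⟩, Subtype.ext hxy⟩
  obtain ⟨z, hz⟩ := IsAlgClosed.exists_pow_nat_eq (-algebraMap 𝔽[X] E X)
    (by omega : 0 < Fintype.card 𝔽 - 1)
  have hz0 : carlitzTheta 𝔽 E z = 0 := by
    obtain ⟨k, hk⟩ := Nat.exists_eq_add_of_le' (by omega : 1 ≤ Fintype.card 𝔽)
    rw [hk, Nat.add_sub_cancel] at hz
    rw [carlitzTheta_apply, hk, pow_succ, hz]; ring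
  have h0T : (0 : E) ∈ T := ⟨zero_mem _, isIntegral_zero⟩
  have hzT : z ∈ T := by
    refine ⟨carlitzTheta_mem_thetaTorsion_iff.mp (hz0 ▸ zero_mem _), ?_⟩
    refine IsIntegral.of_pow (by omega : 0 < Fintype.card 𝔽 - 1) ?_
    rw [hz]
    exact isIntegral_algebraMap.neg
  have h : (⟨z, hzT⟩ : T) = ⟨0, h0T⟩ := hf (Subtype.ext (by simp [f, hz0]))
  have hz' : z = 0 := congrArg Subtype.val h
  rw [hz', zero_pow (by omega), eq_comm, neg_eq_zero] at hz
  exact X_ne_zero ((map_eq_zero_iff _ hinj).mp hz)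

end Torsion

/-! ### Smallness at torsion points -/

section Vanishing

open Polynomial

variable {𝔽 : Type*} [Field 𝔽] [Fintype 𝔽]

variable (𝔽) in
lemma exists_torsionRadius : ∃ ρ : ℝ, 0 < ρ ∧ ρ ^ (Fintype.card 𝔽 - 1) = Fintype.card 𝔽 := by
  have hq : 1 < Fintype.card 𝔽 := Fintype.one_lt_card
  refine ⟨(Fintype.card 𝔽 : ℝ) ^ ((Fintype.card 𝔽 - 1 : ℕ) : ℝ)⁻¹, by positivity, ?_⟩
  exact Real.rpow_inv_natCast_pow (by positivity) (by omega)

variable (𝔽) in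
/-- The absolute value `q ^ (1 / (q - 1))` of the nonzero `θ`-torsion points. -/
def torsionRadius : ℝ := (exists_torsionRadius 𝔽).choose

variable (𝔽) in
lemma torsionRadius_pos : 0 < torsionRadius 𝔽 := (exists_torsionRadius 𝔽).choose_spec.1

variable (𝔽) in
lemma torsionRadius_pow : torsionRadius 𝔽 ^ (Fintype.card 𝔽 - 1) = Fintype.card 𝔽 :=
  (exists_torsionRadius 𝔽).choose_spec.2

variable {L : Type*} [NormedField L] [IsUltrametricDist L] [Algebra 𝔽[X] L] [Algebra 𝔽 L]
  (hnorm : ∀ a : 𝔽[X], a ≠ 0 → ‖algebraMap 𝔽[X] L a‖ = (Fintype.card 𝔽 : ℝ) ^ a.natDegree)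
include hnorm

/-- Outside this disc `x ^ q` dominates `θ x`, so `C_θ` increases the norm and its iterates never
reach `0`. -/
lemma norm_le_torsionRadius {x : L} (hx : x ∈ thetaTorsion 𝔽 L) : ‖x‖ ≤ torsionRadius 𝔽 := by
  obtain ⟨k, hk⟩ := hx
  induction k generalizing x with
  | zero =>
    have : x = 0 := hk
    rw [this, norm_zero]
    exact (torsionRadius_pos 𝔽).le
  | succ k ih =>
    by_contra! hlt
    refine (ih hk).not_gt ?_
    have hq : 1 < Fintype.card 𝔽 := Fintype.one_lt_card
    have hq' : (1 : ℝ) ≤ Fintype.card 𝔽 := by exact_mod_cast hq.le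
    have hx0 : 0 < ‖x‖ := (torsionRadius_pos 𝔽).trans hlt
    have hθ : ‖algebraMap 𝔽[X] L X * x‖ = Fintype.card 𝔽 * ‖x‖ := by
      rw [norm_mul, hnorm X X_ne_zero, natDegree_X, pow_one]
    have hpow : ‖x ^ Fintype.card 𝔽‖ = ‖x‖ ^ (Fintype.card 𝔽 - 1) * ‖x‖ := by
      rw [norm_pow, ← pow_succ, Nat.sub_add_cancel hq.le]
    have hlt' : (Fintype.card 𝔽 : ℝ) < ‖x‖ ^ (Fintype.card 𝔽 - 1) := by
      conv_lhs => rw [← torsionRadius_pow 𝔽]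
      exact pow_lt_pow_left₀ hlt (torsionRadius_pos 𝔽).le (by omega)
    have hlt2 : ‖algebraMap 𝔽[X] L X * x‖ < ‖x ^ Fintype.card 𝔽‖ := by
      rw [hθ, hpow]
      exact mul_lt_mul_of_pos_right hlt' hx0
    rw [carlitzTheta_apply, IsUltrametricDist.norm_add_eq_max_of_norm_ne_norm hlt2.ne,
      max_eq_right hlt2.le]
    calc torsionRadius 𝔽 < ‖x‖ := hlt
      _ ≤ Fintype.card 𝔽 * ‖x‖ := le_mul_of_one_le_left hx0.le hq'
      _ < _ := hθ ▸ hlt2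

/-- Each `C_a(y_i)` is again torsion, so the bound `M` applies to every term; the ultrametric
inequality makes the number of terms irrelevant. -/
lemma norm_eval_smallCoeff_le {σ : Type*} (F : MvPolynomial σ L) {M : ℝ}
    (hM : ∀ z : σ → L, (∀ i, ‖z i‖ ≤ torsionRadius 𝔽) → ‖MvPolynomial.eval z F‖ ≤ M)
    {y : σ → L} (hy : ∀ i, y i ∈ thetaTorsion 𝔽 L) (d : ℕ) :
    ‖MvPolynomial.eval y (smallCoeff (𝔽 := 𝔽) F d)‖ ≤ M / (Fintype.card 𝔽 : ℝ) ^ d := by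
  have hM0 : 0 ≤ M := (norm_nonneg _).trans
    (hM 0 fun i => by simpa using (torsionRadius_pos 𝔽).le)
  rw [smallCoeff, map_sum]
  refine IsUltrametricDist.norm_sum_le_of_forall_le_of_nonneg (by positivity) fun a ha => ?_
  rw [mem_monicsOfDegree] at ha
  rw [MvPolynomial.smul_eval, norm_mul, norm_inv, hnorm a ha.1.ne_zero, ha.2, inv_mul_eq_div]
  gcongr
  have h : MvPolynomial.eval y (starPoly a F) =
      MvPolynomial.eval (fun i => aeval (y i) (carlitzPoly a)) F := by
    have hh : (MvPolynomial.aeval y).comp (starPoly a) =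
        (MvPolynomial.aeval (fun i => aeval (y i) (carlitzPoly a)) : MvPolynomial σ L →ₐ[L] L) := by
      refine MvPolynomial.algHom_ext fun i => ?_
      rw [AlgHom.comp_apply, starPoly, MvPolynomial.aeval_X, MvPolynomial.aeval_X]
      have h := aeval_algHom_apply ((MvPolynomial.aeval (R := L) y).restrictScalars 𝔽[X])
        (MvPolynomial.X i) (carlitzPoly a)
      simpa using h.symm
    have := DFunLike.congr_fun hh F
    rwa [AlgHom.comp_apply, MvPolynomial.aeval_eq_eval, MvPolynomial.aeval_eq_eval] at this
  rw [h]
  exact hM _ fun i => norm_le_torsionRadius hnorm (aeval_carlitzPoly_mem_thetaTorsion a (hy i))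

lemma norm_eval_bigCoeff_lt_one {σ : Type*} (F : MvPolynomial σ L) {M : ℝ}
    (hM : ∀ z : σ → L, (∀ i, ‖z i‖ ≤ torsionRadius 𝔽) → ‖MvPolynomial.eval z F‖ ≤ M)
    {y : σ → L} (hy : ∀ i, y i ∈ thetaTorsion 𝔽 L) {n : ℕ} (hn : M < (Fintype.card 𝔽 : ℝ) ^ n) :
    ‖MvPolynomial.eval y (bigCoeff (𝔽 := 𝔽) F n)‖ < 1 := by
  have hq : (0 : ℝ) < Fintype.card 𝔽 := by exact_mod_cast Fintype.card_pos (α := 𝔽)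
  have hM0 : 0 ≤ M := (norm_nonneg _).trans
    (hM 0 fun i => by simpa using (torsionRadius_pos 𝔽).le)
  rw [bigCoeff, expSeq, map_sum]
  obtain ⟨i, hi, hle⟩ := IsUltrametricDist.exists_norm_finsetSum_le_of_nonempty
    (t := Finset.range (n + 1)) ⟨0, by simp⟩ (fun i => MvPolynomial.eval y
      ((algebraMap 𝔽[X] L (carlitzD 𝔽 i))⁻¹ •
        smallCoeff (𝔽 := 𝔽) F (n - i) ^ Fintype.card 𝔽 ^ i))
  refine hle.trans_lt ?_
  have hin : i ≤ n := Nat.lt_succ_iff.mp (Finset.mem_range.mp hi)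
  -- As `|D_i| = (q ^ i) ^ (q ^ i)`, the whole term is a `q ^ i`-th power, whose base is at most `M
  -- / q ^ n` whatever `i` is.
  rw [MvPolynomial.smul_eval, norm_mul, norm_inv, hnorm _ (carlitzD_ne_zero i), natDegree_carlitzD,
    map_pow, norm_pow, pow_mul, ← inv_pow, ← mul_pow]
  refine pow_lt_one₀ (by positivity) ?_ (pow_ne_zero _ Fintype.card_ne_zero)
  calc ((Fintype.card 𝔽 : ℝ) ^ i)⁻¹ * ‖MvPolynomial.eval y (smallCoeff (𝔽 := 𝔽) F (n - i))‖
      ≤ ((Fintype.card 𝔽 : ℝ) ^ i)⁻¹ * (M / (Fintype.card 𝔽 : ℝ) ^ (n - i)) := by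
        gcongr
        exact norm_eval_smallCoeff_le hnorm F hM hy _
    _ = M / (Fintype.card 𝔽 : ℝ) ^ n := by
        rw [inv_mul_eq_div, div_div, ← pow_add, Nat.sub_add_cancel hin]
    _ < 1 := (div_lt_one (by positivity)).mpr hn

end Vanishing

/-! ### Integral elements with small conjugates -/

section Conjugates

open Polynomial

variable {𝔽 : Type*} [Field 𝔽] {E Ω L : Type*} [Field E] [Field Ω] [IsAlgClosed Ω] [NormedField L]
  [Algebra (RatFunc 𝔽) E] [Algebra.IsAlgebraic (RatFunc 𝔽) E] [Algebra (RatFunc 𝔽) Ω]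
  [Algebra 𝔽[X] E] [IsScalarTower 𝔽[X] (RatFunc 𝔽) E] [Algebra 𝔽[X] L]

/-- An integral element all of whose conjugates are small at infinity vanishes. -/
lemma eq_zero_of_forall_norm_lt_one (j : Ω →+* L)
    (hj : ∀ a : 𝔽[X], j (algebraMap (RatFunc 𝔽) Ω (algebraMap 𝔽[X] (RatFunc 𝔽) a)) =
      algebraMap 𝔽[X] L a)
    (hnorm : ∀ a : 𝔽[X], a ≠ 0 → 1 ≤ ‖algebraMap 𝔽[X] L a‖) {α : E} (hα : IsIntegral 𝔽[X] α)
    (h : ∀ φ : E →ₐ[RatFunc 𝔽] Ω, ‖j (φ α)‖ < 1) : α = 0 := by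
  -- `A` is integrally closed, so the constant term of the minimal polynomial lies in `A`. Up to
  -- sign it is the product of the conjugates, hence of norm less than one, hence zero.
  have hmin := minpoly.isIntegrallyClosed_eq_field_fractions' (RatFunc 𝔽) hα
  set f := (minpoly (RatFunc 𝔽) α).map (algebraMap (RatFunc 𝔽) Ω) with hf
  have hαK : IsIntegral (RatFunc 𝔽) α := Algebra.IsIntegral.isIntegral α
  have hfm : f.Monic := (minpoly.monic hαK).map _
  have hsplit : f.Splits := IsAlgClosed.splits f
  have hroots : ∀ r ∈ f.roots, ‖j r‖ < 1 := by
    intro r hr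
    have hr' : r ∈ (minpoly (RatFunc 𝔽) α).rootSet Ω := by
      rw [mem_rootSet_of_ne (minpoly.ne_zero hαK), aeval_def, eval₂_eq_eval_map]
      exact isRoot_of_mem_roots hr
    rw [← Algebra.IsAlgebraic.range_eval_eq_rootSet_minpoly] at hr'
    obtain ⟨φ, rfl⟩ := hr'
    exact h φ
  have hprod : ∀ s : Multiset Ω, (∀ r ∈ s, ‖j r‖ < 1) → ‖j s.prod‖ ≤ 1 ∧
      (s ≠ 0 → ‖j s.prod‖ < 1) := by
    intro s
    induction s using Multiset.induction_on with
    | empty => simp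
    | cons a s ih =>
      intro hs
      have h1 := hs a (Multiset.mem_cons_self a s)
      have h2 := (ih fun r hr => hs r (Multiset.mem_cons_of_mem hr)).1
      have h3 : ‖j (a ::ₘ s).prod‖ < 1 := by
        rw [Multiset.prod_cons, map_mul, norm_mul]
        exact mul_lt_one_of_nonneg_of_lt_one_left (norm_nonneg _) h1 h2
      exact ⟨h3.le, fun _ => h3⟩
  have hne : f.roots ≠ 0 := by
    intro h0
    have h1 := hsplit.natDegree_eq_card_roots
    rw [h0, Multiset.card_zero, hf, natDegree_map] at h1
    exact (minpoly.natDegree_pos hαK).ne' h1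
  have hlt : ‖j (f.coeff 0)‖ < 1 := by
    rw [hsplit.coeff_zero_eq_prod_roots_of_monic hfm, map_mul, norm_mul, map_pow, map_neg, map_one,
      norm_pow, norm_neg, norm_one, one_pow, one_mul]
    exact (hprod _ hroots).2 hne
  rw [hf, hmin, coeff_map, coeff_map, hj] at hlt
  have h0 : (minpoly 𝔽[X] α).coeff 0 = 0 := by
    by_contra h0
    exact (hnorm _ h0).not_gt hlt
  refine (minpoly.coeff_zero_eq_zero hαK).mp ?_
  rw [hmin, coeff_map, h0, map_zero]

end Conjugates

/-! ### From the power series to the sequence of coefficients -/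

section Coefficients

open Polynomial

variable {𝔽 : Type*} [Field 𝔽] [Fintype 𝔽] {L : Type*} [Field L] [Algebra 𝔽[X] L] {σ : Type*}

lemma coeff_smallL_card_pow (F : MvPolynomial σ L) (d : ℕ) :
    PowerSeries.coeff (Fintype.card 𝔽 ^ d) (smallL 𝔽 F) = smallCoeff (𝔽 := 𝔽) F d := by
  have hinj : ∀ k, Fintype.card 𝔽 ^ d = Fintype.card 𝔽 ^ k ↔ k = d := fun k =>
    (Nat.pow_right_injective Fintype.one_lt_card).eq_iff.trans eq_comm
  let f : 𝔽[X] → MvPolynomial σ L := fun a =>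
    if a.natDegree = d then (algebraMap 𝔽[X] L a)⁻¹ • starPoly a F else 0
  have h1 : PowerSeries.coeff (Fintype.card 𝔽 ^ d) (smallL 𝔽 F) =
      ∑ᶠ a : {a : 𝔽[X] | a.Monic}, f a := by
    rw [smallL, formalSum, PowerSeries.coeff_mk]
    refine finsum_congr fun a => ?_
    rw [smallLTerm_eq, PowerSeries.coeff_monomial]
    simp only [hinj]
    rfl
  rw [h1, finsum_set_coe_eq_finsum_mem, finsum_mem_eq_sum_of_inter_support_eq
    (t := monicsOfDegree 𝔽 d)]
  · refine Finset.sum_congr rfl fun a ha => if_pos (mem_monicsOfDegree.mp ha).2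
  · ext a
    simp only [Set.mem_inter_iff, Finset.mem_coe, mem_monicsOfDegree, Set.mem_ofPred_eq,
      Function.mem_support, f]
    constructor
    · rintro ⟨h, h'⟩
      exact ⟨⟨h, by_contra fun hd => h' (if_neg hd)⟩, h'⟩
    · rintro ⟨h, h'⟩
      exact ⟨h.1, h'⟩

lemma coeff_smallL_eq_zero (F : MvPolynomial σ L) {k : ℕ} (hk : ∀ d, k ≠ Fintype.card 𝔽 ^ d) :
    PowerSeries.coeff k (smallL 𝔽 F) = 0 := by
  rw [smallL, formalSum, PowerSeries.coeff_mk]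
  refine finsum_eq_zero_of_forall_eq_zero fun a => ?_
  rw [smallLTerm_eq, PowerSeries.coeff_monomial, if_neg (hk _)]

variable [Algebra 𝔽 L]

lemma coeff_bigL (F : MvPolynomial σ L) (k : ℕ) :
    PowerSeries.coeff k (bigL 𝔽 F) =
      ∑ᶠ i : ℕ, (algebraMap 𝔽[X] L (carlitzD 𝔽 i))⁻¹ • if Fintype.card 𝔽 ^ i ∣ k then
        PowerSeries.coeff (k / Fintype.card 𝔽 ^ i) (smallL 𝔽 F) ^ Fintype.card 𝔽 ^ i else 0 := by
  rw [bigL, carlitzExp, formalSum, PowerSeries.coeff_mk]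
  refine finsum_congr fun i => ?_
  rw [← coeff_pow_card_pow]
  rfl

lemma coeff_bigL_card_pow (F : MvPolynomial σ L) (n : ℕ) :
    PowerSeries.coeff (Fintype.card 𝔽 ^ n) (bigL 𝔽 F) = bigCoeff (𝔽 := 𝔽) F n := by
  rw [coeff_bigL, finsum_eq_sum_of_support_subset (s := Finset.range (n + 1))]
  · rw [bigCoeff, expSeq]
    refine Finset.sum_congr rfl fun i hi => ?_
    have hin : i ≤ n := Nat.lt_succ_iff.mp (Finset.mem_range.mp hi)
    rw [if_pos (pow_dvd_pow _ hin), Nat.pow_div hin Fintype.card_pos, coeff_smallL_card_pow]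
  · intro i hi
    by_contra h
    rw [Finset.mem_coe, Finset.mem_range] at h
    refine hi ?_
    have : ¬ Fintype.card 𝔽 ^ i ∣ Fintype.card 𝔽 ^ n := by
      rw [Nat.pow_dvd_pow_iff_le_right Fintype.one_lt_card]
      omega
    simp only [if_neg this, smul_zero]

lemma coeff_bigL_eq_zero (F : MvPolynomial σ L) {k : ℕ} (hk : ∀ d, k ≠ Fintype.card 𝔽 ^ d) :
    PowerSeries.coeff k (bigL 𝔽 F) = 0 := by
  rw [coeff_bigL]
  refine finsum_eq_zero_of_forall_eq_zero fun i => ?_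
  split_ifs with h
  · obtain ⟨l, rfl⟩ := h
    rw [Nat.mul_div_cancel_left _ (pow_pos Fintype.card_pos _), coeff_smallL_eq_zero,
      zero_pow (pow_ne_zero _ Fintype.card_ne_zero), smul_zero]
    rintro d rfl
    exact hk (i + d) (pow_add _ _ _).symm
  · exact smul_zero _

/-- `𝔏(F, Z)` is a polynomial if and only if almost all of the coefficients of the `Z ^ (q ^ n)`
vanish. -/
lemma exists_bigL_eq_coe_iff (F : MvPolynomial σ L) :
    (∃ P : Polynomial (MvPolynomial σ L), bigL 𝔽 F = (P : PowerSeries (MvPolynomial σ L))) ↔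
      ∃ n₀, ∀ n ≥ n₀, bigCoeff (𝔽 := 𝔽) F n = 0 := by
  constructor
  · rintro ⟨P, hP⟩
    refine ⟨P.natDegree, fun n hn => ?_⟩
    rw [← coeff_bigL_card_pow, hP, Polynomial.coeff_coe]
    exact coeff_eq_zero_of_natDegree_lt (hn.trans_lt (Nat.lt_pow_self Fintype.one_lt_card))
  · rintro ⟨n₀, h⟩
    refine ⟨PowerSeries.trunc (Fintype.card 𝔽 ^ n₀) (bigL 𝔽 F), ?_⟩
    ext1 k
    rw [Polynomial.coeff_coe, PowerSeries.coeff_trunc]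
    split_ifs with hk
    · rfl
    · by_cases hk' : ∃ d, k = Fintype.card 𝔽 ^ d
      · obtain ⟨d, rfl⟩ := hk'
        rw [coeff_bigL_card_pow]
        exact h d ((Nat.pow_le_pow_iff_right Fintype.one_lt_card).mp (not_lt.mp hk))
      · push Not at hk'
        exact coeff_bigL_eq_zero F hk'

end Coefficients

/-! ### Top-degree coefficients and the Carlitz polynomials `E_n` -/

section TopCoefficients

open Polynomial

lemma coeff_prod_aeval_X {R σ : Type*} [CommRing R] [Fintype σ] (p : σ → R[X]) (m : σ →₀ ℕ) :
    MvPolynomial.coeff m (∏ i, aeval (MvPolynomial.X i : MvPolynomial σ R) (p i)) =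
      ∏ i, (p i).coeff (m i) := by
  classical
  -- Any common bound exceeding every degree and every `m i` would do.
  let N : ℕ := ∑ i, ((p i).natDegree + 1 + (m i + 1))
  have hN : ∀ i, (p i).natDegree + 1 + (m i + 1) ≤ N := fun i =>
    Finset.single_le_sum (f := fun i => (p i).natDegree + 1 + (m i + 1))
      (fun _ _ => Nat.zero_le _) (Finset.mem_univ i)
  have h1 : ∀ i, aeval (MvPolynomial.X i : MvPolynomial σ R) (p i) =
      ∑ k ∈ Finset.range N, MvPolynomial.C ((p i).coeff k) * MvPolynomial.X i ^ k := fun i => by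
    rw [aeval_eq_sum_range' (n := N) (by have := hN i; omega)]
    exact Finset.sum_congr rfl fun k _ => MvPolynomial.smul_eq_C_mul _ _
  have h2 : ∀ f : σ → ℕ, ∏ i, (MvPolynomial.C ((p i).coeff (f i)) * MvPolynomial.X i ^ f i) =
      MvPolynomial.monomial (Finsupp.equivFunOnFinite.symm f) (∏ i, (p i).coeff (f i)) := by
    intro f
    rw [Finset.prod_mul_distrib, MvPolynomial.monomial_eq, map_prod,
      Finsupp.prod_fintype _ _ (fun i => pow_zero _)]
    rfl
  simp only [h1]
  rw [Finset.prod_univ_sum, MvPolynomial.coeff_sum, Finset.sum_eq_single (m : σ → ℕ)]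
  · rw [h2, MvPolynomial.coeff_monomial, if_pos]
    exact Finsupp.equivFunOnFinite.symm_apply_apply m
  · intro f _ hf
    rw [h2, MvPolynomial.coeff_monomial, if_neg]
    rintro rfl
    exact hf (Finsupp.equivFunOnFinite.apply_symm_apply f).symm
  · intro h
    refine absurd (Fintype.mem_piFinset.mpr fun i => ?_) h
    rw [Finset.mem_range]
    have := hN i
    omega

lemma coeff_smul_pow_card_pow (𝔽 : Type*) [Field 𝔽] [Fintype 𝔽] {σ : Type*} {R : Type*} [CommRing R] [Algebra 𝔽 R] (G : MvPolynomial σ R) (i : ℕ) (m : σ →₀ ℕ) :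
    MvPolynomial.coeff (Fintype.card 𝔽 ^ i • m) (G ^ Fintype.card 𝔽 ^ i) =
      MvPolynomial.coeff m G ^ Fintype.card 𝔽 ^ i := by
  classical
  have hQ : Fintype.card 𝔽 ^ i ≠ 0 := pow_ne_zero _ Fintype.card_ne_zero
  conv_lhs => rw [← G.support_sum_monomial_coeff, sum_pow_card_pow]
  simp only [MvPolynomial.monomial_pow, MvPolynomial.coeff_sum, MvPolynomial.coeff_monomial]
  rw [Finset.sum_eq_single m]
  · rw [if_pos rfl]
  · intro k _ hk
    rw [if_neg]
    exact fun h => hk (smul_right_injective _ hQ h)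
  · intro h
    rw [if_pos rfl, MvPolynomial.notMem_support_iff.mp h, zero_pow hQ]

variable {𝔽 : Type*} [Field 𝔽] [Fintype 𝔽] {L : Type*} [Field L] [Algebra 𝔽[X] L] {σ : Type*}

/-- Any other monomial `k` of `F` has degree at most that of `m`, so `k i < m i` for some `i`, and
`C_a(X_i) ^ k i` is too short to reach `X_i ^ (q ^ deg a * m i)`. The monomial `m` itself
contributes a product of leading coefficients, all `1`. -/
lemma coeff_smul_starPoly [Fintype σ] {a : 𝔽[X]} (ha : a.Monic) (F : MvPolynomial σ L)
    {m : σ →₀ ℕ} (hm : F.totalDegree = m.degree) :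
    MvPolynomial.coeff (Fintype.card 𝔽 ^ a.natDegree • m) (starPoly a F) =
      MvPolynomial.coeff m F := by
  classical
  set p : L[X] := (carlitzPoly a).map (algebraMap 𝔽[X] L) with hp
  have hdeg : p.natDegree ≤ Fintype.card 𝔽 ^ a.natDegree :=
    natDegree_map_le.trans (natDegree_carlitzPoly_le a)
  have hlead : p.coeff (Fintype.card 𝔽 ^ a.natDegree) = 1 := by
    rw [hp, coeff_map, coeff_carlitzPoly_of_monic ha, map_one]
  have hmon : ∀ (k : σ →₀ ℕ) (c : L), starPoly a (MvPolynomial.monomial k c) =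
      c • ∏ i, aeval (MvPolynomial.X i : MvPolynomial σ L) (p ^ k i) := by
    intro k c
    rw [starPoly, MvPolynomial.aeval_monomial, ← Algebra.smul_def,
      Finsupp.prod_fintype _ _ (fun i => pow_zero _)]
    congr 1
    refine Finset.prod_congr rfl fun i _ => ?_
    rw [map_pow, hp, aeval_map_algebraMap]
  conv_lhs => rw [← F.support_sum_monomial_coeff]
  rw [map_sum, MvPolynomial.coeff_sum]
  simp only [hmon, MvPolynomial.coeff_smul, coeff_prod_aeval_X, smul_eq_mul, Finsupp.coe_smul,
    Pi.smul_apply]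
  rw [Finset.sum_eq_single m]
  · rw [Finset.prod_eq_one, mul_one]
    intro i _
    rw [mul_comm, coeff_pow_of_natDegree_le hdeg, hlead, one_pow]
  · intro k hk hkm
    obtain ⟨i, hi⟩ : ∃ i, k i < m i := by
      by_contra! hle
      refine hkm (le_antisymm hle ?_).symm
      intro i
      by_contra! hlt
      have h1 : k.degree ≤ m.degree := hm ▸ MvPolynomial.le_totalDegree hk
      have h2 : m.degree < k.degree := by
        rw [Finsupp.degree_eq_sum, Finsupp.degree_eq_sum]
        exact Finset.sum_lt_sum (fun i _ => hle i) ⟨i, Finset.mem_univ i, hlt⟩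
      omega
    rw [Finset.prod_eq_zero (Finset.mem_univ i), mul_zero]
    refine coeff_eq_zero_of_natDegree_lt (natDegree_pow_le.trans_lt ?_)
    calc k i * p.natDegree ≤ k i * Fintype.card 𝔽 ^ a.natDegree := Nat.mul_le_mul_left _ hdeg
      _ < m i * Fintype.card 𝔽 ^ a.natDegree :=
        Nat.mul_lt_mul_of_pos_right hi (pow_pos Fintype.card_pos _)
      _ = _ := mul_comm _ _
  · intro h
    rw [MvPolynomial.notMem_support_iff.mp h, zero_mul]

variable (𝔽) in
/-- The sum of the inverses of the monic polynomials of degree `d`. -/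
def inverseSum (L : Type*) [Field L] [Algebra 𝔽[X] L] (d : ℕ) : L :=
  ∑ a ∈ monicsOfDegree 𝔽 d, (algebraMap 𝔽[X] L a)⁻¹

lemma coeff_smul_smallCoeff [Fintype σ] (F : MvPolynomial σ L)
    {m : σ →₀ ℕ} (hm : F.totalDegree = m.degree) (d : ℕ) :
    MvPolynomial.coeff (Fintype.card 𝔽 ^ d • m) (smallCoeff (𝔽 := 𝔽) F d) =
      inverseSum 𝔽 L d * MvPolynomial.coeff m F := by
  rw [smallCoeff, MvPolynomial.coeff_sum, inverseSum, Finset.sum_mul]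
  refine Finset.sum_congr rfl fun a ha => ?_
  rw [mem_monicsOfDegree] at ha
  rw [MvPolynomial.coeff_smul, smul_eq_mul, ← ha.2, coeff_smul_starPoly ha.1 F hm]

variable (𝔽) in
/-- The Carlitz polynomial `∏ (z - a) / D_n` over the `a` of degree less than `n`, as the
coefficient of `Z ^ (q ^ n)` in `exp_C(z log_C(Z))`. -/
def carlitzE (L : Type*) [Field L] [Algebra 𝔽[X] L] (n : ℕ) : L[X] :=
  ∑ i ∈ Finset.range (n + 1), C ((algebraMap 𝔽[X] L (carlitzD 𝔽 i))⁻¹ *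
    inverseSum 𝔽 L (n - i) ^ Fintype.card 𝔽 ^ i) * X ^ Fintype.card 𝔽 ^ i

lemma natDegree_carlitzE_le (n : ℕ) : (carlitzE 𝔽 L n).natDegree ≤ Fintype.card 𝔽 ^ n := by
  refine natDegree_sum_le_of_forall_le _ _ fun i hi => (natDegree_C_mul_X_pow_le _ _).trans ?_
  exact Nat.pow_le_pow_right Fintype.card_pos (Nat.lt_succ_iff.mp (Finset.mem_range.mp hi))

/-- The coefficient of `X ^ (q ^ n)` is `1 / D_n`, as `1` is the only monic polynomial of degree
`0`. -/
lemma carlitzE_ne_zero (hinj : Function.Injective (algebraMap 𝔽[X] L)) (n : ℕ) :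
    carlitzE 𝔽 L n ≠ 0 := by
  intro h
  have h1 : (carlitzE 𝔽 L n).coeff (Fintype.card 𝔽 ^ n) =
      (algebraMap 𝔽[X] L (carlitzD 𝔽 n))⁻¹ := by
    rw [carlitzE, finsetSum_coeff, Finset.sum_eq_single n]
    · simp [inverseSum, monicsOfDegree_zero]
    · intro i _ hi
      rw [coeff_C_mul_X_pow, if_neg]
      exact fun h => hi (Nat.pow_right_injective Fintype.one_lt_card h).symm
    · intro h
      exact absurd (Finset.self_mem_range_succ n) h
  rw [h, coeff_zero, eq_comm, inv_eq_zero, map_eq_zero_iff _ hinj] at h1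
  exact carlitzD_ne_zero n h1

variable [Algebra 𝔽 L]

/-- The top coefficients of the coefficient of `Z ^ (q ^ n)` in `𝔏(F, Z)`. -/
lemma coeff_smul_bigCoeff [Fintype σ] (F : MvPolynomial σ L)
    {m : σ →₀ ℕ} (hm : F.totalDegree = m.degree) (n : ℕ) :
    MvPolynomial.coeff (Fintype.card 𝔽 ^ n • m) (bigCoeff (𝔽 := 𝔽) F n) =
      (carlitzE 𝔽 L n).eval (MvPolynomial.coeff m F) := by
  rw [bigCoeff, expSeq, MvPolynomial.coeff_sum, carlitzE, eval_finsetSum]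
  refine Finset.sum_congr rfl fun i hi => ?_
  have hin : i ≤ n := Nat.lt_succ_iff.mp (Finset.mem_range.mp hi)
  have hn : Fintype.card 𝔽 ^ n • m = Fintype.card 𝔽 ^ i • Fintype.card 𝔽 ^ (n - i) • m := by
    rw [smul_smul, ← pow_add, Nat.add_sub_cancel' hin]
  rw [MvPolynomial.coeff_smul, hn, coeff_smul_pow_card_pow, coeff_smul_smallCoeff F hm]
  simp only [eval_mul, eval_C, eval_pow, eval_X, smul_eq_mul, mul_pow]
  ring

end TopCoefficients

/-! ### The absolute value of `C_∞` -/

section Norm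

variable (𝔽 : Type*) [Field 𝔽] [Fintype 𝔽]

instance isUltrametricDist_KinfAlgCl : IsUltrametricDist (KinfAlgCl 𝔽) :=
  IsUltrametricDist.isUltrametricDist_of_isNonarchimedean_norm
    (isNonarchimedean_spectralNorm (K := Kinf 𝔽) (L := KinfAlgCl 𝔽))

instance isUltrametricDist_Cinf : IsUltrametricDist (Cinf 𝔽) := by
  refine IsUltrametricDist.isUltrametricDist_of_forall_norm_add_le_max_norm
    (S' := UniformSpace.Completion (KinfAlgCl 𝔽)) fun x y => ?_
  induction x, y using UniformSpace.Completion.induction_on₂ with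
  | hp => exact isClosed_le (by fun_prop) (by fun_prop)
  | ih x y =>
    rw [← UniformSpace.Completion.coe_add]
    simpa only [UniformSpace.Completion.norm_coe] using IsUltrametricDist.norm_add_le_max x y

lemma norm_algebraMap_Cinf {a : Polynomial 𝔽} (ha : a ≠ 0) :
    ‖algebraMap (Polynomial 𝔽) (Cinf 𝔽) a‖ = (Fintype.card 𝔽 : ℝ) ^ a.natDegree := by
  let r : RatFunc 𝔽 := algebraMap (Polynomial 𝔽) (RatFunc 𝔽) a
  have h1 : ‖algebraMap (Polynomial 𝔽) (Cinf 𝔽) a‖ = ‖algebraMap (RatFunc 𝔽) (Kinf 𝔽) r‖ := by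
    refine Eq.trans (UniformSpace.Completion.norm_coe (E := KinfAlgCl 𝔽) _) ?_
    exact spectralNorm_extends (K := Kinf 𝔽) (L := KinfAlgCl 𝔽) _
  rw [h1]
  let _ := Classical.decEq (RatFunc 𝔽)
  let _ := RatFunc.inftyValued 𝔽
  have h : (Valued.v ((r : RatFunc 𝔽) : UniformSpace.Completion (RatFunc 𝔽)) :
        WithZero (Multiplicative ℤ)) = WithZero.exp (a.natDegree : ℤ) := by
    rw [Valued.valuedCompletion_apply]
    exact RatFunc.inftyValuation.polynomial 𝔽 ha
  have h2 : (Valued.v (algebraMap (RatFunc 𝔽) (Kinf 𝔽) r) : WithZero (Multiplicative ℤ))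
      = WithZero.exp (a.natDegree : ℤ) := h
  have h3 : ‖algebraMap (RatFunc 𝔽) (Kinf 𝔽) r‖ =
    ((WithZeroMulInt.toNNReal (one_lt_card 𝔽).ne_zero
      (Valued.v (algebraMap (RatFunc 𝔽) (Kinf 𝔽) r) : WithZero (Multiplicative ℤ)) : ℝ≥0) : ℝ) := by
    refine congrArg NNReal.toReal ?_
    change WithZeroMulInt.toNNReal (one_lt_card 𝔽).ne_zero
      (MonoidWithZeroHom.ValueGroup₀.embedding _) = _
    rw [Valuation.embedding_restrict]
  rw [h3, h2, WithZeroMulInt.toNNReal_neg_apply _ WithZero.exp_ne_zero]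
  have h4 : (WithZero.unzero (WithZero.exp_ne_zero (a := (a.natDegree : ℤ)))) =
      Multiplicative.ofAdd (a.natDegree : ℤ) := WithZero.unzero_coe _
  rw [h4]
  simp

universe u in
-- Conjugates are taken in an algebraically closed field mapping to `C_∞`, so that algebraic
-- closedness of `C_∞` itself is not needed.
lemma exists_isAlgClosed_ringHom_Cinf (𝔽 : Type u) [Field 𝔽] [Fintype 𝔽] :
    ∃ (Ω : Type u) (_ : Field Ω) (_ : IsAlgClosed Ω) (_ : Algebra (RatFunc 𝔽) Ω) (j : Ω →+* Cinf 𝔽),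
      j.comp (algebraMap (RatFunc 𝔽) Ω) = ratFuncToCinf 𝔽 := by
  refine ⟨KinfAlgCl 𝔽, inferInstance, inferInstance,
    ((algebraMap (Kinf 𝔽) (KinfAlgCl 𝔽)).comp (algebraMap (RatFunc 𝔽) (Kinf 𝔽))).toAlgebra,
    UniformSpace.Completion.coeRingHom, rfl⟩

end Norm

/-! ### Boundedness of polynomials on polydiscs -/

section Bound

open Polynomial

lemma exists_forall_norm_eval_le {L σ : Type*} [NormedField L] (F : MvPolynomial σ L) (r : ℝ) :
    ∃ M : ℝ, ∀ z : σ → L, (∀ i, ‖z i‖ ≤ r) → ‖MvPolynomial.eval z F‖ ≤ M := by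
  refine ⟨∑ k ∈ F.support, ‖F.coeff k‖ * ∏ i ∈ k.support, r ^ k i, fun z hz => ?_⟩
  rw [MvPolynomial.eval_eq]
  refine norm_sum_le_of_le _ fun k _ => ?_
  rw [norm_mul, norm_prod]
  gcongr with i _
  rw [norm_pow]
  gcongr
  exact hz i

end Bound

/-! ### The two inclusions -/

section Main

open Polynomial

variable (𝔽 : Type*) [Field 𝔽] [Fintype 𝔽]

instance algebraCinf : Algebra 𝔽 (Cinf 𝔽) :=
  ((algebraMap 𝔽[X] (Cinf 𝔽)).comp C).toAlgebra

variable {𝔽} {σ : Type*}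

/-- Anderson's theorem, quantitative form: if `F ∈ A[X]` is bounded by `M` on the closed polydisc
containing the torsion points, the coefficients of `Z ^ (q ^ n)` in `𝔏(F, Z)` vanish for
`q ^ n > M`. -/
theorem bigCoeff_map_eq_zero (F : MvPolynomial σ 𝔽[X]) {M : ℝ}
    (hM : ∀ z : σ → Cinf 𝔽, (∀ i, ‖z i‖ ≤ torsionRadius 𝔽) →
      ‖MvPolynomial.eval z (MvPolynomial.map (algebraMap 𝔽[X] (Cinf 𝔽)) F)‖ ≤ M)
    {n : ℕ} (hn : M < (Fintype.card 𝔽 : ℝ) ^ n) :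
    bigCoeff (𝔽 := 𝔽) (MvPolynomial.map (algebraMap 𝔽[X] (Cinf 𝔽)) F) n = 0 := by
  have hinj := algebraMap_Cinf_injective 𝔽
  have hnorm : ∀ a : 𝔽[X], a ≠ 0 →
      ‖algebraMap 𝔽[X] (Cinf 𝔽) a‖ = (Fintype.card 𝔽 : ℝ) ^ a.natDegree :=
    fun a ha => norm_algebraMap_Cinf 𝔽 ha
  have hq : (1 : ℝ) ≤ Fintype.card 𝔽 := by exact_mod_cast Fintype.card_pos (α := 𝔽)
  obtain ⟨Ω, _, _, _, j, hj⟩ := exists_isAlgClosed_ringHom_Cinf 𝔽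
  have hj' : ∀ a : 𝔽[X], j (algebraMap (RatFunc 𝔽) Ω (algebraMap 𝔽[X] (RatFunc 𝔽) a)) =
      algebraMap 𝔽[X] (Cinf 𝔽) a := fun a => DFunLike.congr_fun hj _
  obtain ⟨g, hg⟩ := exists_map_eq_bigCoeff hinj F n
  rw [← hg]
  let E := AlgebraicClosure (RatFunc 𝔽)
  have hinjE : Function.Injective (algebraMap 𝔽[X] E) := by
    rw [IsScalarTower.algebraMap_eq 𝔽[X] (RatFunc 𝔽) E]
    exact (algebraMap (RatFunc 𝔽) E).injective.comp (IsFractionRing.injective 𝔽[X] (RatFunc 𝔽))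
  suffices h : MvPolynomial.map (algebraMap 𝔽[X] E) g = 0 by
    rw [(MvPolynomial.map_injective _ hinjE) (h.trans (map_zero _).symm), map_zero]
  -- A polynomial vanishing on a product of infinite sets is zero; here each factor is the set of
  -- integral torsion points.
  refine MvPolynomial.funext_set (fun _ => {x : E | x ∈ thetaTorsion 𝔽 E ∧ IsIntegral 𝔽[X] x})
    (fun _ => infinite_integral_thetaTorsion hinjE) fun x hx => ?_
  have hx' : ∀ i, x i ∈ thetaTorsion 𝔽 E ∧ IsIntegral 𝔽[X] (x i) := fun i => hx i (Set.mem_univ i)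
  rw [map_zero]
  refine eq_zero_of_forall_norm_lt_one j hj' (fun a ha => ?_) ?_ fun φ => ?_
  · rw [hnorm a ha]
    exact one_le_pow₀ hq
  · rw [MvPolynomial.eval_map, MvPolynomial.eval₂_eq]
    exact IsIntegral.sum _ fun k _ => isIntegral_algebraMap.mul
      (IsIntegral.prod _ fun i _ => (hx' i).2.pow _)
  · have hψ : ∀ a, (j.comp (φ : E →+* Ω)) (algebraMap 𝔽[X] E a) = algebraMap 𝔽[X] (Cinf 𝔽) a := by
      intro a
      rw [IsScalarTower.algebraMap_apply 𝔽[X] (RatFunc 𝔽) E, RingHom.comp_apply, ← hj']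
      congr 1
      exact φ.commutes _
    have h1 : j (φ (MvPolynomial.eval x (MvPolynomial.map (algebraMap 𝔽[X] E) g))) =
        MvPolynomial.eval (fun i => j (φ (x i)))
          (MvPolynomial.map (algebraMap 𝔽[X] (Cinf 𝔽)) g) := by
      rw [MvPolynomial.eval_map, MvPolynomial.eval_map]
      refine (MvPolynomial.hom_eval₂ g _ (j.comp (φ : E →+* Ω)) x).trans ?_
      congr 1
      exact RingHom.ext hψ
    -- A conjugate of the value at `x` is the value of `L_n` at the conjugate point, which is again
    -- torsion, so the smallness bound applies.
    rw [h1, hg]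
    exact norm_eval_bigCoeff_lt_one hnorm _ hM
      (fun i => map_mem_thetaTorsion (j.comp (φ : E →+* Ω)) hψ (hx' i).1) hn

theorem exists_forall_bigCoeff_map_eq_zero (F : MvPolynomial σ 𝔽[X]) :
    ∃ n₀, ∀ n ≥ n₀, bigCoeff (𝔽 := 𝔽) (MvPolynomial.map (algebraMap 𝔽[X] (Cinf 𝔽)) F) n = 0 := by
  have hq : (1 : ℝ) < Fintype.card 𝔽 := by exact_mod_cast Fintype.one_lt_card (α := 𝔽)
  obtain ⟨M, hM⟩ := exists_forall_norm_eval_le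
    (MvPolynomial.map (algebraMap 𝔽[X] (Cinf 𝔽)) F) (torsionRadius 𝔽)
  obtain ⟨n₀, hn₀⟩ := pow_unbounded_of_one_lt M hq
  exact ⟨n₀, fun n hn => bigCoeff_map_eq_zero F hM
    (hn₀.trans_le (pow_le_pow_right₀ hq.le hn))⟩

/-- For the constant `F = a`, in zero variables, `E_n(a)` is the coefficient `L_n` itself; the bound
`M = |a|` is less than `q ^ n`. -/
lemma eval_carlitzE_algebraMap {n : ℕ} {a : 𝔽[X]} (ha : a.degree < n) :
    (carlitzE 𝔽 (Cinf 𝔽) n).eval (algebraMap 𝔽[X] (Cinf 𝔽) a) = 0 := by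
  have hq : (1 : ℝ) < Fintype.card 𝔽 := by exact_mod_cast Fintype.one_lt_card (α := 𝔽)
  have h := coeff_smul_bigCoeff (𝔽 := 𝔽) (MvPolynomial.map (σ := Fin 0)
    (algebraMap 𝔽[X] (Cinf 𝔽)) (MvPolynomial.C a)) (m := 0) (by simp) n
  rw [bigCoeff_map_eq_zero (M := ‖algebraMap 𝔽[X] (Cinf 𝔽) a‖), MvPolynomial.coeff_zero,
    MvPolynomial.map_C, MvPolynomial.coeff_zero_C] at h
  · exact h.symm
  · intro z _
    rw [MvPolynomial.map_C, MvPolynomial.eval_C]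
  · by_cases h0 : a = 0
    · rw [h0, map_zero, norm_zero]
      positivity
    · rw [norm_algebraMap_Cinf 𝔽 h0]
      exact pow_lt_pow_right₀ hq ((natDegree_lt_iff_degree_lt h0).mpr ha)

/-- The roots of the Carlitz polynomial are the polynomials of degree less than `n`. -/
lemma exists_algebraMap_eq_of_eval_carlitzE {n : ℕ} {f : Cinf 𝔽}
    (hf : (carlitzE 𝔽 (Cinf 𝔽) n).eval f = 0) : ∃ a : 𝔽[X], algebraMap 𝔽[X] (Cinf 𝔽) a = f := by
  classical
  by_contra! hne
  have hinj := algebraMap_Cinf_injective 𝔽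
  let e : (Fin n → 𝔽) → Cinf 𝔽 := fun v =>
    algebraMap 𝔽[X] (Cinf 𝔽) ((degreeLTEquiv 𝔽 n).symm v : 𝔽[X])
  have he : Function.Injective e :=
    hinj.comp (Subtype.val_injective.comp (degreeLTEquiv 𝔽 n).symm.injective)
  let Z : Finset (Cinf 𝔽) := insert f (Finset.univ.image e)
  have hZ : Z.card = Fintype.card 𝔽 ^ n + 1 := by
    rw [Finset.card_insert_of_notMem, Finset.card_image_of_injective _ he, Finset.card_univ,
      Fintype.card_fun, Fintype.card_fin]
    simp only [Finset.mem_image, not_exists, not_and]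
    exact fun v _ => hne _
  refine carlitzE_ne_zero hinj n (eq_zero_of_natDegree_lt_card_of_eval_eq_zero' _ Z ?_ ?_)
  · intro z hz
    rcases Finset.mem_insert.mp hz with rfl | hz
    · exact hf
    · obtain ⟨v, _, rfl⟩ := Finset.mem_image.mp hz
      exact eval_carlitzE_algebraMap (mem_degreeLT.mp ((degreeLTEquiv 𝔽 n).symm v).2)
  · rw [hZ]
    exact (natDegree_carlitzE_le n).trans_lt (Nat.lt_succ_self _)

/-- A coefficient of maximal total degree is a root of some `E_n`, hence lies in `A`. Removing its
monomial preserves the hypothesis, because `L_n` is additive in `F` and the removed monomial, being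
over `A`, satisfies it too. -/
theorem exists_map_eq_of_forall_bigCoeff_eq_zero [Fintype σ] (F : MvPolynomial σ (Cinf 𝔽))
    (hF : ∃ n₀, ∀ n ≥ n₀, bigCoeff (𝔽 := 𝔽) F n = 0) :
    ∃ G, MvPolynomial.map (algebraMap 𝔽[X] (Cinf 𝔽)) G = F := by
  induction hk : F.support.card using Nat.strong_induction_on generalizing F with
  | _ k ih =>
  by_cases hF0 : F = 0
  · exact ⟨0, by rw [hF0, map_zero]⟩
  obtain ⟨m, hm, hmax⟩ := Finset.exists_mem_eq_sup F.support
    (MvPolynomial.support_nonempty.mpr hF0) (fun k => k.degree)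
  have hdeg : F.totalDegree = m.degree := by
    rw [← hmax, MvPolynomial.totalDegree]
    rfl
  obtain ⟨n₀, hn₀⟩ := hF
  obtain ⟨a, ha⟩ := exists_algebraMap_eq_of_eval_carlitzE (𝔽 := 𝔽) (n := n₀)
    (f := MvPolynomial.coeff m F) (by
      rw [← coeff_smul_bigCoeff F hdeg, hn₀ n₀ le_rfl, MvPolynomial.coeff_zero])
  let N : MvPolynomial σ 𝔽[X] := MvPolynomial.monomial m (-a)
  obtain ⟨n₁, hn₁⟩ := exists_forall_bigCoeff_map_eq_zero N
  have hN : MvPolynomial.map (algebraMap 𝔽[X] (Cinf 𝔽)) N =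
      -MvPolynomial.monomial m (MvPolynomial.coeff m F) := by
    rw [MvPolynomial.map_monomial, map_neg, ha, map_neg]
  have hlt : (F + MvPolynomial.map (algebraMap 𝔽[X] (Cinf 𝔽)) N).support.card < k := by
    classical
    rw [← hk]
    refine Finset.card_lt_card (Finset.ssubset_iff_subset_ne.mpr ⟨fun l hl => ?_, fun h => ?_⟩)
    · rw [MvPolynomial.mem_support_iff] at hl ⊢
      intro h0
      refine hl ?_
      rw [hN, MvPolynomial.coeff_add, MvPolynomial.coeff_neg, MvPolynomial.coeff_monomial, h0]
      split_ifs with h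
      · rw [h, h0]; ring
      · ring
    · rw [← h, MvPolynomial.mem_support_iff, hN, MvPolynomial.coeff_add, MvPolynomial.coeff_neg,
        MvPolynomial.coeff_monomial, if_pos rfl, add_neg_cancel] at hm
      exact hm rfl
  obtain ⟨G, hG⟩ := ih _ hlt _ ⟨max n₀ n₁, fun n hn => by
    rw [bigCoeff_add, hn₀ n ((le_max_left _ _).trans hn), hn₁ n ((le_max_right _ _).trans hn),
      add_zero]⟩ rfl
  exact ⟨G - N, by rw [map_sub, hG, add_sub_cancel_right]⟩

end Main

end CarlitzLog

end

theorem mainTheorem6 (𝔽 : Type*) [Field 𝔽] [Fintype 𝔽] (s : ℕ) (hs : 1 ≤ s) :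
    {F : MvPolynomial (Fin s) (CarlitzLog.Cinf 𝔽) |
        ∃ P : Polynomial (MvPolynomial (Fin s) (CarlitzLog.Cinf 𝔽)),
          CarlitzLog.bigL 𝔽 F = (P : PowerSeries (MvPolynomial (Fin s) (CarlitzLog.Cinf 𝔽)))} =
      Set.range (MvPolynomial.map (algebraMap (Polynomial 𝔽) (CarlitzLog.Cinf 𝔽)) :
        MvPolynomial (Fin s) (Polynomial 𝔽) →
          MvPolynomial (Fin s) (CarlitzLog.Cinf 𝔽)) := by
  ext F
  rw [Set.mem_ofPred_eq, CarlitzLog.exists_bigL_eq_coe_iff, Set.mem_range]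
  constructor
  · exact CarlitzLog.exists_map_eq_of_forall_bigCoeff_eq_zero F
  · rintro ⟨G, rfl⟩
    exact CarlitzLog.exists_forall_bigCoeff_map_eq_zero G
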